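/- All logarithms are to base 2. Graphs are simple, undirected and carry a positive real weight on every edge. For a graph with $n$ nodes and $m$ edges let $\rho$ be the ratio of its largest to its smallest edge weight ($\rho=1$ if there is no edge). MWC is the problem of computing the weight of a minimum weight simple cycle ($\infty$ if there is none), and APSD is the problem of computing the shortest path distances for all pairs of nodes ($\infty$ if unreachable). The machine is a random access machine in which integers can be copied, incremented, decremented and compared, and nonnegative real weights (and $\infty$) can be copied, added and compared, each at unit cost; a graph is given as a list of its edges. **Theorem.** (a) There is a single algorithm with oracle access to APSD that computes MWC on every weighted undirected graph $G$ with $n$ nodes, $m$ edges and edge weight ratio $\rho$ such that * it makes at most $2\,\lceil\log n\rceil\,(\lfloor\log\rho\rfloor+1)$ calls to APSD (at most $0$ if $n\le 1$); * each call is on a graph with exactly $2n$ nodes, at most $2m$ edges and edge weight ratio at most $\rho$, and this graph is written down in $O(n+m)$ steps; * the nodes of each such graph are two copies of the nodes of $G$ (nodes $v$ and $n+v$ being the copies of $v$), every edge of it joins copies of the two endpoints of an edge of $G$, and has the same weight as that edge; * the additional processing time, outside of constructing these graphs and of the calls, is $O(n^2\cdot\log n\cdot\log(n\rho)+1)$.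 (b) Hence MWC tilde-$n^2$ sparse reduces to APSD, $\mathrm{MWC}\lesssim^{\mathrm{sprs}}_{n^2}\mathrm{APSD}$. That is, there is an algorithm with oracle access to APSD that solves MWC with $\tilde O(1)$ calls on graphs with $\tilde O(n)$ nodes and $\tilde O(m)$ edges, and if a call on a graph with $m'$ edges and $n'$ nodes is answered by an algorithm that takes time $T(m',n')$, then the total running time, including the calls, is $\tilde O(T(m,n)+n^2+1)$. Here $\tilde O$ hides a factor polylogarithmic in $n$ and one factor $1+\log\rho$, and $T$ is any time bound that is monotone in both arguments and satisfies $T(2m,2n)=O(T(m,n)+1)$. -/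

import Mathlib

open scoped NNReal ENNReal

namespace SparseReduction

noncomputable section

/-! ### Weighted undirected graphs, cycles and distances -/

/-- A simple undirected graph on `n` nodes with a positive real weight on every edge.
(The weight function is set to `0` off the edges, so that it carries no further data.) -/
structure WGraph (n : ℕ) where
  graph : SimpleGraph (Fin n)
  weight : Sym2 (Fin n) → ℝ≥0
  weight_pos : ∀ e ∈ graph.edgeSet, 0 < weight e
  weight_off : ∀ e, e ∉ graph.edgeSet → weight e = 0

namespace WGraph

variable {n : ℕ} (G : WGraph n)

/-- The number of edges. -/
def numEdges : ℕ := G.graph.edgeSet.ncard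

/-- The total weight of a walk, edges counted with multiplicity. -/
def walkWeight {x y : Fin n} (p : G.graph.Walk x y) : ℝ≥0∞ :=
  (p.edges.map fun e => (G.weight e : ℝ≥0∞)).sum

/-- Shortest path distance; `∞` if `y` is not reachable from `x`. -/
def dist (x y : Fin n) : ℝ≥0∞ := ⨅ p : G.graph.Walk x y, G.walkWeight p

/-- The weight of a minimum weight (simple) cycle; `∞` if the graph is acyclic. -/
def minCycleWeight : ℝ≥0∞ :=
  ⨅ (v : Fin n) (c : G.graph.Walk v v) (_ : c.IsCycle), G.walkWeight c

/-- The largest edge weight. -/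
def maxWeight : ℝ≥0 := sSup (G.weight '' G.graph.edgeSet)

/-- The smallest edge weight. -/
def minWeight : ℝ≥0 := sInf (G.weight '' G.graph.edgeSet)

/-- The edge weight ratio `ρ`: largest over smallest edge weight (`1` if there is no edge). -/
def ratio : ℝ := if G.numEdges = 0 then 1 else G.maxWeight / G.minWeight

/-- `l` lists every edge exactly once, in some order and with some order of its endpoints. -/
def IsEdgeList (l : List (Fin n × Fin n)) : Prop :=
  (l.map fun p => s(p.1, p.2)).Nodup ∧
    ∀ e, e ∈ G.graph.edgeSet ↔ e ∈ l.map fun p => s(p.1, p.2)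

/-- The edge list as machine data: triples (endpoint, endpoint, weight). -/
def encode (l : List (Fin n × Fin n)) : List (ℕ × ℕ × ℝ≥0∞) :=
  l.map fun p => ((p.1 : ℕ), (p.2 : ℕ), (G.weight s(p.1, p.2) : ℝ≥0∞))

end WGraph

/-- A problem on weighted undirected graphs whose answer is a table of extended nonnegative
reals, of a format that depends on the number of nodes. -/
structure GraphProblem where
  rows : ℕ → ℕ
  cols : ℕ → ℕ
  answer : ∀ {n : ℕ}, WGraph n → Fin (rows n) → Fin (cols n) → ℝ≥0∞

/-- The answer as a two-dimensional array, filled up with `0` outside its format. -/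
def GraphProblem.table (Q : GraphProblem) {n : ℕ} (G : WGraph n) (i j : ℕ) : ℝ≥0∞ :=
  if h : i < Q.rows n ∧ j < Q.cols n then Q.answer G ⟨i, h.1⟩ ⟨j, h.2⟩ else 0

/-- Minimum Weight Cycle: compute the weight of a minimum weight cycle. -/
def MWC : GraphProblem where
  rows _ := 1
  cols _ := 1
  answer G _ _ := G.minCycleWeight

/-- All Pairs Shortest Distances: compute the distance of every pair of nodes. -/
def APSD : GraphProblem where
  rows n := n
  cols n := n
  answer G x y := G.dist x y

/-! ### The machine

A random access machine with finitely many integer and weight registers and finitely many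
two-dimensional integer and weight arrays. Integers can only be copied, incremented,
decremented and compared, so every integer that occurs is at most the input size plus a constant
times the number of steps. Weights (nonnegative reals and `∞`) can only be copied, added and
compared. A program is a finite text of a structured language; each executed instruction and each
evaluated test costs one step. -/

structure State where
  /-- integer registers -/
  ireg : ℕ → ℕ
  /-- weight registers -/
  wreg : ℕ → ℝ≥0∞
  /-- integer arrays: array name, row, column -/
  iarr : ℕ → ℕ → ℕ → ℕ
  /-- weight arrays: array name, row, column -/
  warr : ℕ → ℕ → ℕ → ℝ≥0∞
  /-- the edge list of the oracle query that is being written -/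
  query : List (ℕ × ℕ × ℝ≥0∞)

/-- Integer expressions. -/
inductive IExp where
  | lit (k : ℕ)
  | reg (x : ℕ)
  | get (a : ℕ) (i j : IExp)
  | succ (e : IExp)
  | pred (e : IExp)

def IExp.eval (s : State) : IExp → ℕ
  | .lit k => k
  | .reg x => s.ireg x
  | .get a i j => s.iarr a (i.eval s) (j.eval s)
  | .succ e => e.eval s + 1
  | .pred e => e.eval s - 1

/-- Weight expressions. -/
inductive WExp where
  | zero
  | top
  | reg (x : ℕ)
  | get (a : ℕ) (i j : IExp)
  | add (e f : WExp)

def WExp.eval (s : State) : WExp → ℝ≥0∞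
  | .zero => 0
  | .top => ⊤
  | .reg x => s.wreg x
  | .get a i j => s.warr a (i.eval s) (j.eval s)
  | .add e f => e.eval s + f.eval s

/-- Tests. -/
inductive Test where
  | ilt (e f : IExp)
  | wlt (e f : WExp)
  | not (b : Test)
  | and (b c : Test)

def Test.Holds (s : State) : Test → Prop
  | .ilt e f => e.eval s < f.eval s
  | .wlt e f => e.eval s < f.eval s
  | .not b => ¬ b.Holds s
  | .and b c => b.Holds s ∧ c.Holds s

/-- Programs. `edge u v w` appends an edge to the current oracle query; `call c k` starts an empty
query, runs `c` to write its edges, and then asks the oracle about that graph on `k` nodes. -/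
inductive Prog where
  | skip
  | setI (x : ℕ) (e : IExp)
  | setW (x : ℕ) (e : WExp)
  | putI (a : ℕ) (i j : IExp) (e : IExp)
  | putW (a : ℕ) (i j : IExp) (e : WExp)
  | seq (c d : Prog)
  | ite (b : Test) (c d : Prog)
  | while (b : Test) (c : Prog)
  | edge (u v : IExp) (w : WExp)
  | call (c : Prog) (k : IExp)

/-- A record of one oracle call: the graph, and the time spent on writing it. -/
structure Call where
  order : ℕ
  graph : WGraph order
  buildTime : ℕ

/-- The weight array that receives the oracle's answers. -/
def answerArray : ℕ := 1

/-- The weight array that holds the output when the program stops. -/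
def outputArray : ℕ := 2

def setEntry {α : Type} (f : ℕ → ℕ → ℕ → α) (a i j : ℕ) (v : α) : ℕ → ℕ → ℕ → α :=
  Function.update f a (Function.update (f a) i (Function.update (f a i) j v))

/-- `Run Q c s s' t calls`: with an oracle for `Q`, the program `c` started in state `s` stops in
state `s'`, makes the oracle calls `calls` (in this order), and spends `t` steps outside of
writing oracle queries; the steps that write a query are recorded with the call. -/
inductive Run (Q : GraphProblem) : Prog → State → State → ℕ → List Call → Prop where
  | skip (s) : Run Q .skip s s 1 []
  | setI (s x e) :
      Run Q (.setI x e) s { s with ireg := Function.update s.ireg x (e.eval s) } 1 []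
  | setW (s x e) :
      Run Q (.setW x e) s { s with wreg := Function.update s.wreg x (e.eval s) } 1 []
  | putI (s a i j e) :
      Run Q (.putI a i j e) s
        { s with iarr := setEntry s.iarr a (i.eval s) (j.eval s) (e.eval s) } 1 []
  | putW (s a i j e) :
      Run Q (.putW a i j e) s
        { s with warr := setEntry s.warr a (i.eval s) (j.eval s) (e.eval s) } 1 []
  | seq {c d s s₁ s₂ t₁ t₂ q₁ q₂} :
      Run Q c s s₁ t₁ q₁ → Run Q d s₁ s₂ t₂ q₂ → Run Q (.seq c d) s s₂ (t₁ + t₂) (q₁ ++ q₂)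
  | iteTrue {b c d s s' t q} :
      b.Holds s → Run Q c s s' t q → Run Q (.ite b c d) s s' (t + 1) q
  | iteFalse {b c d s s' t q} :
      ¬ b.Holds s → Run Q d s s' t q → Run Q (.ite b c d) s s' (t + 1) q
  | whileStop {b c s} :
      ¬ b.Holds s → Run Q (.while b c) s s 1 []
  | whileStep {b c s s₁ s₂ t₁ t₂ q₁ q₂} :
      b.Holds s → Run Q c s s₁ t₁ q₁ → Run Q (.while b c) s₁ s₂ t₂ q₂ →
        Run Q (.while b c) s s₂ (t₁ + t₂ + 1) (q₁ ++ q₂)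
  | edge (s u v w) :
      Run Q (.edge u v w) s
        { s with query := s.query ++ [(u.eval s, v.eval s, w.eval s)] } 1 []
  | call {c k s s₁ t} (H : WGraph (k.eval s₁)) (l : List (Fin (k.eval s₁) × Fin (k.eval s₁))) :
      Run Q c { s with query := [] } s₁ t [] →
      H.IsEdgeList l → s₁.query = H.encode l →
        Run Q (.call c k) s
          { s₁ with warr := Function.update s₁.warr answerArray (Q.table H), query := [] }
          1 [⟨k.eval s₁, H, t⟩]

/-- The initial state for a graph given by an edge list: registers `0` and `1` hold the numbers of
nodes and edges, row `e` of integer array `0` holds the endpoints of the `e`-th edge and row `e` of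
weight array `0` its weight; everything else is `0`. -/
def initState {n : ℕ} (G : WGraph n) (l : List (Fin n × Fin n)) : State where
  ireg x := if x = 0 then n else if x = 1 then l.length else 0
  wreg _ := 0
  iarr a e j :=
    if a = 0 ∧ j = 0 then ((G.encode l).getD e (0, 0, 0)).1
    else if a = 0 ∧ j = 1 then ((G.encode l).getD e (0, 0, 0)).2.1
    else 0
  warr a e j := if a = 0 ∧ j = 0 then ((G.encode l).getD e (0, 0, 0)).2.2 else 0
  query := []

/-- The final state `s` contains the answer of problem `P` on `G`. -/
def Solves (P : GraphProblem) {n : ℕ} (G : WGraph n) (s : State) : Prop :=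
  ∀ (i : Fin (P.rows n)) (j : Fin (P.cols n)), s.warr outputArray i j = P.answer G i j

/-! ### Sparsity preserving reductions -/

/-- Time bounds `T m n` for graphs with `m` edges and `n` nodes that are monotone and grow by at
most a constant factor when both parameters are doubled. -/
def RegularBound (T : ℕ → ℕ → ℕ) : Prop :=
  (∀ m m' n n', m ≤ m' → n ≤ n' → T m n ≤ T m' n') ∧
    ∃ κ : ℕ, ∀ m n, T (2 * m) (2 * n) ≤ κ * (T m n + 1)

/-- The factors hidden in `Õ`: a polylogarithm of `n` and one factor `log ρ`. -/
def tildeFactor (K d n : ℕ) (ρ : ℝ) : ℝ :=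
  K * (1 + Real.logb 2 n) ^ d * (1 + Real.logb 2 ρ)

/-- The total time of a run if an oracle call on a graph with `m` edges and `n` nodes is answered
by an algorithm that takes time `T m n`. -/
def totalTime (T : ℕ → ℕ → ℕ) (t : ℕ) (calls : List Call) : ℕ :=
  t + (calls.map fun q => q.buildTime + T q.graph.numEdges q.order).sum

/-- `P` tilde-`f(m,n)` sparse reduces to `Q`: one program with an oracle for `Q` solves `P` with
polylogarithmically many oracle calls on graphs with `Õ(n)` nodes and `Õ(m)` edges, and whenever
the oracle is answered by an algorithm for `Q` that runs in time `T m n`, the whole computation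
takes time `Õ(T m n + f m n)`. -/
def TildeSparseReduces (P Q : GraphProblem) (f : ℕ → ℕ → ℕ) : Prop :=
  ∃ c : Prog, ∀ T : ℕ → ℕ → ℕ, RegularBound T → ∃ K d : ℕ,
    ∀ (n : ℕ) (G : WGraph n) (l : List (Fin n × Fin n)), G.IsEdgeList l →
      ∃ (s : State) (t : ℕ) (calls : List Call),
        Run Q c (initState G l) s t calls ∧
        Solves P G s ∧
        (calls.length : ℝ) ≤ tildeFactor K d n G.ratio ∧
        (∀ q ∈ calls,
          (q.order : ℝ) ≤ tildeFactor K d n G.ratio * n ∧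
          (q.graph.numEdges : ℝ) ≤ tildeFactor K d n G.ratio * G.numEdges) ∧
        (totalTime T t calls : ℝ) ≤
          tildeFactor K d n G.ratio * (T G.numEdges n + f G.numEdges n + 1)

end

end SparseReduction

open SparseReduction

open scoped NNReal ENNReal

namespace SparseReduction

noncomputable section

/-! ### Walk weights, distances and cycles -/

namespace WGraph

variable {n : ℕ} (G : WGraph n)

/-! Write d for distances and w for weights. On a cycle through y let z be a vertex farthest from y,
with cycle neighbours u ≠ v. Then d(y,u), d(y,v) ≤ d(y,z), and the cycle weighs at least (d(y,u) +
w(u,z)) + (d(y,v) + w(v,z)) (`exists_neighbors_of_isCycle`). Conversely, whenever u ≠ v are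
neighbours of z with d(y,u) < d(y,z) + w(u,z) and likewise for v, this sum bounds the weight of some
cycle (`minCycleWeight_le_of_neighbors`). So the minimum cycle weight is the minimum of these sums,
and two things must be arranged: u and v must be kept apart, and detours that reach u via z and turn
back must be excluded.

To keep u and v apart, the edges are oriented by ⌈log n⌉ tournaments given by the binary digits of
|u - v| - 1. For any u ≠ v adjacent to z, one tournament orients uz and vz differently with respect
to z (`exists_orient`). For each tournament and for its reverse, the oracle is asked about two
copies of the nodes: all of G on the first copy, and a cross edge from u to the second copy of z for
each arc. The distance from y to the second copy of z is then the best d(y,u) + w(u,z) over the arcs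
uz.

To exclude detours, cross edges are restricted to weights in a scale [a, 2a), and a cross distance
is accepted only if it is below d(y,z) + 2a. Accepted values come from some u with d(y,u) < d(y,z) +
w(u,z), because w(u,z) ≥ a (`soundAt_relax`). Every u with d(y,u) ≤ d(y,z) passes the test, because
w(u,z) < 2a (`completeAt_relax_neg`). Doubling a from the smallest weight gives at most ⌊log ρ⌋ + 1
scales (`IsExtremes.exists_scales`).

The rest implements this on the machine. A Hoare-style logic `Ensures` bounds steps and calls, and
the frame lemma `Run.frame` keeps track of untouched memory. -/

lemma walkWeight_nil (x : Fin n) : G.walkWeight (SimpleGraph.Walk.nil : G.graph.Walk x x) = 0 := by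
  simp [walkWeight]

lemma walkWeight_cons {x y z : Fin n} (h : G.graph.Adj x y) (p : G.graph.Walk y z) :
    G.walkWeight (p.cons h) = G.weight s(x, y) + G.walkWeight p := by
  simp [walkWeight]

lemma walkWeight_append {x y z : Fin n} (p : G.graph.Walk x y) (q : G.graph.Walk y z) :
    G.walkWeight (p.append q) = G.walkWeight p + G.walkWeight q := by
  simp [walkWeight, SimpleGraph.Walk.edges_append]

lemma walkWeight_concat {x y z : Fin n} (p : G.graph.Walk x y) (h : G.graph.Adj y z) :
    G.walkWeight (p.concat h) = G.walkWeight p + G.weight s(y, z) := by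
  simp [walkWeight, SimpleGraph.Walk.edges_concat]

lemma walkWeight_reverse {x y : Fin n} (p : G.graph.Walk x y) :
    G.walkWeight p.reverse = G.walkWeight p := by
  simp [walkWeight, SimpleGraph.Walk.edges_reverse]

lemma walkWeight_eq_sum {x y : Fin n} (p : G.graph.Walk x y) (hp : p.IsTrail) :
    G.walkWeight p = ∑ e ∈ p.edges.toFinset, (G.weight e : ℝ≥0∞) := by
  rw [walkWeight, List.sum_toFinset _ hp.edges_nodup]

lemma dist_le {x y : Fin n} (p : G.graph.Walk x y) : G.dist x y ≤ G.walkWeight p := iInf_le _ p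

lemma dist_self (x : Fin n) : G.dist x x = 0 :=
  nonpos_iff_eq_zero.1 ((G.dist_le .nil).trans (G.walkWeight_nil x).le)

lemma walkWeight_bypass_le {x y : Fin n} (p : G.graph.Walk x y) :
    G.walkWeight p.bypass ≤ G.walkWeight p := by
  rw [walkWeight_eq_sum _ _ p.bypass_isPath.isTrail]
  have hsub : p.bypass.edges.toFinset ⊆ p.edges.toFinset := fun e he => by
    simpa using p.edges_bypass_subset_edges (by simpa using he)
  refine (Finset.sum_le_sum_of_subset hsub).trans ?_
  rw [walkWeight, Finset.sum_list_map_count]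
  refine Finset.sum_le_sum fun e he => ?_
  have : 1 ≤ p.edges.count e := List.count_pos_iff.2 (by simpa using he)
  rw [nsmul_eq_mul]
  exact le_mul_of_one_le_left' (by exact_mod_cast this)

/-- A finite distance is attained by a simple path. -/
lemma exists_isPath_walkWeight_eq_dist {x y : Fin n} (h : G.dist x y ≠ ⊤) :
    ∃ p : G.graph.Walk x y, p.IsPath ∧ G.walkWeight p = G.dist x y := by
  have hne : Nonempty (G.graph.Walk x y) := by
    by_contra hc
    rw [not_nonempty_iff] at hc
    exact h (by simp [dist])
  let S : Set ℝ≥0∞ := {a | ∃ p : G.graph.Walk x y, p.IsPath ∧ G.walkWeight p = a}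
  have hfin : S.Finite := by
    -- The weight of a simple path depends only on its edge set, so only finitely many values occur
    -- and the infimum is attained.
    refine (Set.finite_range fun F : Finset (Sym2 (Fin n)) =>
      ∑ e ∈ F, (G.weight e : ℝ≥0∞)).subset ?_
    rintro _ ⟨p, hp, rfl⟩
    exact ⟨_, (G.walkWeight_eq_sum p hp.isTrail).symm⟩
  have hS : S.Nonempty := ⟨_, hne.some.bypass, hne.some.bypass_isPath, rfl⟩
  obtain ⟨p, hp, hw⟩ := hS.csInf_mem hfin
  refine ⟨p, hp, le_antisymm ?_ (G.dist_le p)⟩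
  rw [hw]
  refine le_iInf fun q => le_trans ?_ (G.walkWeight_bypass_le q)
  exact sInf_le ⟨q.bypass, q.bypass_isPath, rfl⟩

lemma dist_le_dist_add {x y z : Fin n} (h : G.graph.Adj y z) :
    G.dist x z ≤ G.dist x y + G.weight s(y, z) := by
  by_cases ht : G.dist x y = ⊤
  · simp [ht]
  obtain ⟨p, -, hp⟩ := G.exists_isPath_walkWeight_eq_dist ht
  rw [← hp, ← walkWeight_concat _ p h]
  exact G.dist_le _

/-- A weight preserving homomorphism does not increase distances. -/
lemma dist_hom_le {k : ℕ} {H : WGraph k} (f : H.graph →g G.graph)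
    (hf : ∀ e ∈ H.graph.edgeSet, G.weight (e.map f) = H.weight e) (x y : Fin k) :
    G.dist (f x) (f y) ≤ H.dist x y := by
  refine le_iInf fun p => (G.dist_le (p.map f)).trans (le_of_eq ?_)
  rw [walkWeight, walkWeight, SimpleGraph.Walk.edges_map, List.map_map]
  congr 1
  refine List.map_congr_left fun e he => ?_
  simp [hf e (p.edges_subset_edgeSet he)]

/-- Two distinct simple paths with the same ends contain a cycle. -/
lemma minCycleWeight_le_of_paths {x y : Fin n} (p q : G.graph.Walk x y) (hp : p.IsPath)
    (hq : q.IsPath) (hne : p ≠ q) : G.minCycleWeight ≤ G.walkWeight p + G.walkWeight q := by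
  -- Paths in a forest are unique, so the edges of the two paths together cannot form a forest.
  let E : Set (Sym2 (Fin n)) := {e | e ∈ p.edges ∨ e ∈ q.edges}
  let F := SimpleGraph.fromEdgeSet E
  have hmem : ∀ e ∈ F.edgeSet, e ∈ p.edges ∨ e ∈ q.edges := fun e he => by
    rw [SimpleGraph.edgeSet_fromEdgeSet] at he
    exact he.1
  have hF : ∀ e, e ∈ p.edges ∨ e ∈ q.edges → e ∈ F.edgeSet := fun e he => by
    rw [SimpleGraph.edgeSet_fromEdgeSet]
    refine ⟨he, ?_⟩
    rcases he with he | he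
    · exact G.graph.not_isDiag_of_mem_edgeSet (p.edges_subset_edgeSet he)
    · exact G.graph.not_isDiag_of_mem_edgeSet (q.edges_subset_edgeSet he)
  have hFG : F ≤ G.graph := fun a b hab => by
    rcases hmem s(a, b) hab with h | h
    · exact p.edges_subset_edgeSet h
    · exact q.edges_subset_edgeSet h
  have hpF : ∀ e ∈ p.edges, e ∈ F.edgeSet := fun e he => hF e (Or.inl he)
  have hqF : ∀ e ∈ q.edges, e ∈ F.edgeSet := fun e he => hF e (Or.inr he)
  have hcyc : ¬ F.IsAcyclic := fun hac => by
    have h := (hac.subsingleton_path x y).elim ⟨p.transfer F hpF, hp.transfer hpF⟩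
      ⟨q.transfer F hqF, hq.transfer hqF⟩
    have h2 : p.transfer F hpF = q.transfer F hqF := congrArg Subtype.val h
    apply hne
    apply SimpleGraph.Walk.ext_support
    rw [← p.support_transfer hpF, ← q.support_transfer hqF, h2]
  simp only [SimpleGraph.IsAcyclic, not_forall, not_not] at hcyc
  obtain ⟨v, c, hc⟩ := hcyc
  have hc' : (c.mapLe hFG).IsCycle := hc.mapLe hFG
  have hle : G.minCycleWeight ≤ G.walkWeight (c.mapLe hFG) :=
    iInf_le_of_le v (iInf_le_of_le _ (iInf_le (fun _ => G.walkWeight (c.mapLe hFG)) hc'))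
  refine hle.trans ?_
  -- No edge repeats on the cycle or on either path, so all weights are sums over edge sets, and the
  -- cycle lies in the union.
  rw [walkWeight_eq_sum _ _ hc'.isTrail, walkWeight_eq_sum _ _ hp.isTrail,
    walkWeight_eq_sum _ _ hq.isTrail, ← Finset.sum_union_inter]
  refine (Finset.sum_le_sum_of_subset fun e he => ?_).trans le_self_add
  have he' : e ∈ c.edges := by simpa using he
  simpa using hmem e (c.edges_subset_edgeSet he')

/-- A walk from `y` through `u` to a neighbor `z` of `u` that is not a mere detour via `z`
is a simple path, or else it contains a short cycle. -/
lemma minCycleWeight_le_or_exists_isPath {y z u : Fin n} (h : G.graph.Adj u z)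
    (hlt : G.dist y u < G.dist y z + G.weight s(u, z)) :
    G.minCycleWeight ≤ G.dist y u + G.weight s(u, z) ∨
      ∃ p : G.graph.Walk y u, (p.concat h).IsPath ∧
        G.walkWeight (p.concat h) = G.dist y u + G.weight s(u, z) := by
  obtain ⟨p, hp, hw⟩ := G.exists_isPath_walkWeight_eq_dist hlt.ne_top
  -- If z lies on the shortest path to u, then by `hlt` the piece from z to u is lighter than the
  -- edge uz. It therefore differs from that edge, and the two contain a cycle.
  by_cases hz : z ∈ p.support
  · left
    have hsplit : G.walkWeight (p.takeUntil z hz) + G.walkWeight (p.dropUntil z hz) =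
        G.dist y u := by
      rw [← walkWeight_append, p.take_spec hz, hw]
    have hdrop : G.walkWeight (p.dropUntil z hz) < G.weight s(u, z) := by
      have h1 : G.walkWeight (p.takeUntil z hz) + G.walkWeight (p.dropUntil z hz) <
          G.walkWeight (p.takeUntil z hz) + G.weight s(u, z) := by
        rw [hsplit]
        exact hlt.trans_le (by gcongr; exact G.dist_le _)
      exact lt_of_add_lt_add_left h1
    have h2 := G.minCycleWeight_le_of_paths (p.dropUntil z hz)
      (SimpleGraph.Walk.cons h.symm .nil) (hp.dropUntil hz) (by simp [h.ne']) (by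
        intro heq
        rw [heq, walkWeight_cons, walkWeight_nil, Sym2.eq_swap] at hdrop
        simp at hdrop)
    rw [walkWeight_cons, walkWeight_nil, add_zero, Sym2.eq_swap] at h2
    refine h2.trans ?_
    rw [← hsplit]
    gcongr
    exact le_add_self
  · right
    exact ⟨p, hp.concat hz h, by rw [walkWeight_concat, hw]⟩

/-- Unless one of the extended shortest paths already yields a light cycle, both are simple paths
from y to z, and they differ in their penultimate vertex. -/
lemma minCycleWeight_le_of_neighbors {y z u v : Fin n} (hu : G.graph.Adj u z)
    (hv : G.graph.Adj v z) (huv : u ≠ v) (hu' : G.dist y u < G.dist y z + G.weight s(u, z))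
    (hv' : G.dist y v < G.dist y z + G.weight s(v, z)) :
    G.minCycleWeight ≤ (G.dist y u + G.weight s(u, z)) + (G.dist y v + G.weight s(v, z)) := by
  rcases G.minCycleWeight_le_or_exists_isPath hu hu' with h | ⟨p, hp, hpw⟩
  · exact h.trans le_self_add
  rcases G.minCycleWeight_le_or_exists_isPath hv hv' with h | ⟨q, hq, hqw⟩
  · exact h.trans le_add_self
  rw [← hpw, ← hqw]
  refine G.minCycleWeight_le_of_paths _ _ hp hq fun heq => huv ?_
  have := congrArg SimpleGraph.Walk.penultimate heq
  simpa using this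

/-- On a cycle through `y`, the two neighbors of a vertex `z` farthest from `y` are not farther
from `y` than `z`. -/
lemma exists_neighbors_of_isCycle {y : Fin n} (c : G.graph.Walk y y) (hc : c.IsCycle) :
    ∃ z u v : Fin n, u ≠ v ∧ G.graph.Adj u z ∧ G.graph.Adj v z ∧ G.dist y u ≤ G.dist y z ∧
      G.dist y v ≤ G.dist y z ∧
      (G.dist y u + G.weight s(u, z)) + (G.dist y v + G.weight s(v, z)) ≤ G.walkWeight c := by
  have hsnd : c.snd ∈ c.support.toFinset.erase y := by
    have h := c.adj_snd hc.not_nil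
    simp [h.ne']
  -- Excluding y guarantees z ≠ y, so both arcs of the cycle between y and z are nonempty. Since
  -- d(y,y) = 0, z is still farthest among all vertices of the cycle.
  obtain ⟨z, hz, hmax⟩ := Finset.exists_max_image (c.support.toFinset.erase y) (G.dist y) ⟨_, hsnd⟩
  have hzy : z ≠ y := (Finset.mem_erase.1 hz).1
  have hzc : z ∈ c.support := by simpa using (Finset.mem_erase.1 hz).2
  have hle : ∀ x ∈ c.support, G.dist y x ≤ G.dist y z := fun x hx => by
    by_cases hxy : x = y
    · simp [hxy, dist_self]
    · exact hmax x (by simp [hxy, hx])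
  set p := c.takeUntil z hzc
  set q := c.dropUntil z hzc
  have hspec : p.append q = c := c.take_spec hzc
  have hpn : ¬ p.Nil := SimpleGraph.Walk.not_nil_of_ne hzy.symm
  have hqn : ¬ q.Nil := SimpleGraph.Walk.not_nil_of_ne hzy
  have hpa := p.adj_penultimate hpn
  have hqa := q.adj_snd hqn
  have hpe : s(p.penultimate, z) ∈ p.edges := SimpleGraph.Walk.mk_penultimate_end_mem_edges hpn
  have hqe : s(z, q.snd) ∈ q.edges := SimpleGraph.Walk.mk_start_snd_mem_edges hqn
  -- The two arcs share no edge; this is what makes the two neighbours of z distinct.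
  have hnd : (p.edges ++ q.edges).Nodup := by
    rw [← SimpleGraph.Walk.edges_append, hspec]
    exact hc.isTrail.edges_nodup
  refine ⟨z, p.penultimate, q.snd, ?_, hpa, hqa.symm, ?_, ?_, ?_⟩
  · intro heq
    rw [Sym2.eq_swap, ← heq, Sym2.eq_swap] at hqe
    refine (List.nodup_append.1 hnd).2.2 _ hpe _ ?_ rfl
    rwa [Sym2.eq_swap]
  · exact hle _ (c.support_takeUntil_subset_support hzc (by simp [p]))
  · exact hle _ (c.support_dropUntil_subset_support hzc (by simp [q]))
  · have h1 : G.walkWeight p = G.walkWeight p.dropLast + G.weight s(p.penultimate, z) := by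
      rw [← walkWeight_concat _ _ hpa, SimpleGraph.Walk.concat_dropLast]
    have h2 : G.walkWeight q = G.weight s(q.snd, z) + G.walkWeight q.tail := by
      rw [Sym2.eq_swap, ← walkWeight_cons _ hqa, q.cons_tail_eq hqn]
    rw [← hspec, walkWeight_append, h1, h2, add_comm (G.weight s(q.snd, z) : ℝ≥0∞)]
    gcongr
    · exact G.dist_le _
    · rw [← walkWeight_reverse]
      exact G.dist_le _

/-! ### The two copy graph -/

section TwoCopies

lemma pos_of_fin_two_mul (a : Fin (2 * n)) : 0 < n := by
  have := a.2
  omega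

/-- The node of `G` of which `a` is a copy. -/
def proj (a : Fin (2 * n)) : Fin n := ⟨a % n, Nat.mod_lt _ (pos_of_fin_two_mul a)⟩

/-- The first copy of a node. -/
def lo (x : Fin n) : Fin (2 * n) := ⟨x, by omega⟩

/-- The second copy of a node. -/
def hi (x : Fin n) : Fin (2 * n) := ⟨x + n, by omega⟩

@[simp] lemma proj_lo (x : Fin n) : proj (lo x) = x := by
  ext; simp [proj, lo, Nat.mod_eq_of_lt x.2]

@[simp] lemma proj_hi (x : Fin n) : proj (hi x) = x := by
  ext; simp [proj, hi, Nat.mod_eq_of_lt x.2]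

lemma eq_lo_of_lt (a : Fin (2 * n)) (h : (a : ℕ) < n) : a = lo (proj a) := by
  ext; simp [proj, lo, Nat.mod_eq_of_lt h]

lemma eq_hi_of_le (a : Fin (2 * n)) (h : n ≤ (a : ℕ)) : a = hi (proj a) := by
  have := a.2
  ext
  simp only [proj, hi]
  rw [Nat.mod_eq_sub_mod h, Nat.mod_eq_of_lt (by omega)]
  omega

lemma coe_lo (x : Fin n) : (lo x : ℕ) = x := rfl

lemma coe_hi (x : Fin n) : (hi x : ℕ) = n + x := Nat.add_comm _ _

lemma lo_lt (x : Fin n) : (lo x : ℕ) < n := x.2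

lemma not_hi_lt (x : Fin n) : ¬ (hi x : ℕ) < n := by simp [hi]

/-- The graph of `twoCopies`. -/
def twoCopiesGraph (r : Fin n → Fin n → Prop) : SimpleGraph (Fin (2 * n)) where
  Adj a b := G.graph.Adj (proj a) (proj b) ∧
    (((a : ℕ) < n ∧ (b : ℕ) < n) ∨ ((a : ℕ) < n ∧ ¬ (b : ℕ) < n ∧ r (proj a) (proj b)) ∨
      ((b : ℕ) < n ∧ ¬ (a : ℕ) < n ∧ r (proj b) (proj a)))
  symm := ⟨fun a b h => ⟨h.1.symm, by tauto⟩⟩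
  loopless := ⟨fun a h => h.1.ne rfl⟩

lemma map_proj_mem_edgeSet {r : Fin n → Fin n → Prop} {e : Sym2 (Fin (2 * n))}
    (he : e ∈ (G.twoCopiesGraph r).edgeSet) : e.map proj ∈ G.graph.edgeSet := by
  induction e using Sym2.ind with
  | _ a b => exact he.1

open Classical in
/-- All edges of `G` in the first copy of its nodes, and an edge from the first copy of `u` to the
second copy of `z` for every edge `{u, z}` of `G` with `r u z`. -/
def twoCopies (r : Fin n → Fin n → Prop) : WGraph (2 * n) where
  graph := G.twoCopiesGraph r
  weight e := if e ∈ (G.twoCopiesGraph r).edgeSet then G.weight (e.map proj) else 0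
  weight_pos e he := by
    rw [if_pos he]
    exact G.weight_pos _ (G.map_proj_mem_edgeSet he)
  weight_off e he := if_neg he

variable (r : Fin n → Fin n → Prop)

lemma twoCopies_weight {e : Sym2 (Fin (2 * n))} (he : e ∈ (G.twoCopies r).graph.edgeSet) :
    (G.twoCopies r).weight e = G.weight (e.map proj) := if_pos he

lemma twoCopies_adj_lo_lo {x y : Fin n} :
    (G.twoCopies r).graph.Adj (lo x) (lo y) ↔ G.graph.Adj x y := by
  simp [twoCopies, twoCopiesGraph, lo_lt]

lemma twoCopies_adj_lo_hi {x y : Fin n} :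
    (G.twoCopies r).graph.Adj (lo x) (hi y) ↔ G.graph.Adj x y ∧ r x y := by
  simp only [twoCopies, twoCopiesGraph, proj_lo, proj_hi, lo_lt, not_hi_lt]
  simp

lemma not_twoCopies_adj_hi_hi {x y : Fin n} : ¬ (G.twoCopies r).graph.Adj (hi x) (hi y) := by
  simp [twoCopies, twoCopiesGraph, not_hi_lt]

/-- The projection to `G`. -/
def projHom : (G.twoCopies r).graph →g G.graph := ⟨proj, fun h => h.1⟩

/-- The inclusion of the first copy. -/
def loHom : G.graph →g (G.twoCopies r).graph := ⟨lo, fun h => (G.twoCopies_adj_lo_lo r).2 h⟩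

lemma twoCopies_weight_lo_lo {x y : Fin n} (h : G.graph.Adj x y) :
    (G.twoCopies r).weight s(lo x, lo y) = G.weight s(x, y) := by
  rw [twoCopies_weight _ _ ((G.twoCopies_adj_lo_lo r).2 h)]
  simp

lemma twoCopies_weight_lo_hi {x y : Fin n} (h : G.graph.Adj x y) (hr : r x y) :
    (G.twoCopies r).weight s(lo x, hi y) = G.weight s(x, y) := by
  rw [twoCopies_weight _ _ ((G.twoCopies_adj_lo_hi r).2 ⟨h, hr⟩)]
  simp

/-- The inclusion of the first copy and the projection both preserve weights, so neither increases
distances. Hence the answer to a single query contains d(y,z) as well as the cross distance it is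
compared with. -/
lemma twoCopies_dist_lo_lo (y z : Fin n) :
    (G.twoCopies r).dist (lo y) (lo z) = G.dist y z := by
  refine le_antisymm ?_ ?_
  · refine dist_hom_le _ (G.loHom r) (fun e he => ?_) y z
    induction e using Sym2.ind with
    | _ a b => exact G.twoCopies_weight_lo_lo r he
  · have := G.dist_hom_le (G.projHom r) (fun e he => (G.twoCopies_weight r he).symm) (lo y) (lo z)
    simpa [projHom] using this

/-- A shortest path from the first copy of `y` to the second copy of `z` ends with an edge
from the first to the second copy. -/
lemma exists_twoCopies_dist_lo_hi {y z : Fin n} (h : (G.twoCopies r).dist (lo y) (hi z) ≠ ⊤) :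
    ∃ u, G.graph.Adj u z ∧ r u z ∧
      G.dist y u + G.weight s(u, z) ≤ (G.twoCopies r).dist (lo y) (hi z) := by
  obtain ⟨p, -, hw⟩ := exists_isPath_walkWeight_eq_dist _ h
  have hn : ¬ p.Nil := SimpleGraph.Walk.not_nil_of_ne fun heq => not_hi_lt z (heq ▸ lo_lt y)
  have hadj := p.adj_penultimate hn
  -- Second copies are pairwise nonadjacent, so the penultimate node is a first copy. The part
  -- before it may visit second copies, which does not matter after projection.
  by_cases hlt : (p.penultimate : ℕ) < n
  · have hlo := eq_lo_of_lt _ hlt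
    set u := proj p.penultimate
    have hadj' := hadj
    rw [hlo] at hadj'
    obtain ⟨h1, h2⟩ := (G.twoCopies_adj_lo_hi r).1 hadj'
    refine ⟨u, h1, h2, ?_⟩
    have hsum : (G.twoCopies r).walkWeight p.dropLast + G.weight s(u, z) =
        (G.twoCopies r).dist (lo y) (hi z) := by
      rw [← hw, ← twoCopies_weight_lo_hi _ r h1 h2, ← hlo, ← walkWeight_concat _ _ hadj,
        SimpleGraph.Walk.concat_dropLast]
    rw [← hsum, ← G.twoCopies_dist_lo_lo r, ← hlo]
    gcongr
    exact dist_le _ _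
  · have hhi := eq_hi_of_le _ (not_lt.1 hlt)
    rw [hhi] at hadj
    exact absurd hadj (G.not_twoCopies_adj_hi_hi r)

lemma twoCopies_dist_lo_hi_le {y z u : Fin n} (h : G.graph.Adj u z) (hr : r u z) :
    (G.twoCopies r).dist (lo y) (hi z) ≤ G.dist y u + G.weight s(u, z) := by
  rw [← G.twoCopies_dist_lo_lo r, ← G.twoCopies_weight_lo_hi r h hr]
  exact dist_le_dist_add _ ((G.twoCopies_adj_lo_hi r).2 ⟨h, hr⟩)

/-! ### Edge lists -/

lemma IsEdgeList.numEdges_eq {G : WGraph n} {l : List (Fin n × Fin n)} (h : G.IsEdgeList l) :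
    G.numEdges = l.length := by
  classical
  have : G.graph.edgeSet = ((l.map fun p => s(p.1, p.2)).toFinset : Set (Sym2 (Fin n))) := by
    ext e
    simpa using h.2 e
  rw [numEdges, this, Set.ncard_coe_finset, List.toFinset_card_of_nodup h.1, List.length_map]

lemma IsEdgeList.adj {G : WGraph n} {l : List (Fin n × Fin n)} (h : G.IsEdgeList l)
    {p : Fin n × Fin n} (hp : p ∈ l) : G.graph.Adj p.1 p.2 :=
  (h.2 s(p.1, p.2)).2 (List.mem_map.2 ⟨p, hp, rfl⟩)

lemma IsEdgeList.exists_mem {G : WGraph n} {l : List (Fin n × Fin n)} (h : G.IsEdgeList l)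
    {u v : Fin n} (huv : G.graph.Adj u v) : (u, v) ∈ l ∨ (v, u) ∈ l := by
  obtain ⟨p, hp, he⟩ := List.mem_map.1 ((h.2 s(u, v)).1 huv)
  rcases Sym2.eq_iff.1 he with ⟨h1, h2⟩ | ⟨h1, h2⟩
  · left; rwa [← h1, ← h2]
  · right; rwa [← h1, ← h2]

open Classical in
/-- The edges of `twoCopies` that are copies of a given edge. -/
def copies (p : Fin n × Fin n) : List (Fin (2 * n) × Fin (2 * n)) :=
  (lo p.1, lo p.2) ::
    ((if r p.1 p.2 then [(lo p.1, hi p.2)] else []) ++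
      if r p.2 p.1 then [(lo p.2, hi p.1)] else [])

lemma mem_copies {r : Fin n → Fin n → Prop} {p : Fin n × Fin n} {q : Fin (2 * n) × Fin (2 * n)} :
    q ∈ copies r p ↔ q = (lo p.1, lo p.2) ∨ (r p.1 p.2 ∧ q = (lo p.1, hi p.2)) ∨
      (r p.2 p.1 ∧ q = (lo p.2, hi p.1)) := by
  unfold copies
  split_ifs with h1 h2 h2 <;> simp [h1, h2]

lemma map_proj_of_mem_copies {r : Fin n → Fin n → Prop} {p : Fin n × Fin n}
    {q : Fin (2 * n) × Fin (2 * n)} (h : q ∈ copies r p) :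
    (s(q.1, q.2)).map proj = s(p.1, p.2) := by
  rcases mem_copies.1 h with rfl | ⟨-, rfl⟩ | ⟨-, rfl⟩
  · simp
  · simp
  · simp [Sym2.eq_swap]

lemma lo_ne_hi (x y : Fin n) : lo x ≠ hi y := fun h => not_hi_lt y (h ▸ lo_lt x)

lemma nodup_copies (p : Fin n × Fin n) (hp : ¬ (r p.1 p.2 ∧ r p.2 p.1)) :
    ((copies r p).map fun q => s(q.1, q.2)).Nodup := by
  unfold copies
  split_ifs with h1 h2 h2 <;> simp_all [lo_ne_hi]

lemma isEdgeList_twoCopies {l : List (Fin n × Fin n)} (h : G.IsEdgeList l)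
    (hr : ∀ u v, G.graph.Adj u v → ¬ (r u v ∧ r v u)) :
    (G.twoCopies r).IsEdgeList (l.flatMap (copies r)) := by
  constructor
  · rw [List.map_flatMap, List.nodup_flatMap]
    refine ⟨fun p hp => nodup_copies r p (hr _ _ (h.adj hp)), ?_⟩
    have hp := List.pairwise_map.1 h.1
    refine hp.imp fun {p q} hpq => ?_
    intro e he1 he2
    obtain ⟨a, ha, rfl⟩ := List.mem_map.1 he1
    obtain ⟨b, hb, hab⟩ := List.mem_map.1 he2
    apply hpq
    rw [← map_proj_of_mem_copies ha, ← map_proj_of_mem_copies hb, hab]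
  · intro e
    simp only [List.mem_map, List.mem_flatMap]
    constructor
    -- Every edge has an end in the first copy; up to a swap it is the first one.
    · have key : ∀ a b : Fin (2 * n), (a : ℕ) < n → (G.twoCopies r).graph.Adj a b →
          ∃ q, (∃ p ∈ l, q ∈ copies r p) ∧ s(q.1, q.2) = s(a, b) := by
        intro a b ha hab
        rw [eq_lo_of_lt a ha] at hab ⊢
        generalize proj a = x at hab ⊢
        by_cases hb : (b : ℕ) < n
        · rw [eq_lo_of_lt b hb] at hab ⊢
          generalize proj b = y at hab ⊢
          rcases h.exists_mem ((G.twoCopies_adj_lo_lo r).1 hab) with hm | hm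
          · exact ⟨_, ⟨_, hm, mem_copies.2 (Or.inl rfl)⟩, rfl⟩
          · exact ⟨_, ⟨_, hm, mem_copies.2 (Or.inl rfl)⟩, Sym2.eq_swap⟩
        · rw [eq_hi_of_le b (not_lt.1 hb)] at hab ⊢
          generalize proj b = y at hab ⊢
          obtain ⟨h1, h2⟩ := (G.twoCopies_adj_lo_hi r).1 hab
          rcases h.exists_mem h1 with hm | hm
          · exact ⟨_, ⟨_, hm, mem_copies.2 (Or.inr (Or.inl ⟨h2, rfl⟩))⟩, rfl⟩
          · exact ⟨_, ⟨_, hm, mem_copies.2 (Or.inr (Or.inr ⟨h2, rfl⟩))⟩, rfl⟩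
      induction e using Sym2.ind with
      | _ a b =>
        intro hab
        by_cases ha : (a : ℕ) < n
        · exact key a b ha hab
        by_cases hb : (b : ℕ) < n
        · rw [Sym2.eq_swap]
          exact key b a hb hab.symm
        · rw [eq_hi_of_le a (not_lt.1 ha), eq_hi_of_le b (not_lt.1 hb)] at hab
          exact absurd hab (G.not_twoCopies_adj_hi_hi r)
    · rintro ⟨q, ⟨p, hp, hq⟩, rfl⟩
      have hadj := h.adj hp
      rcases mem_copies.1 hq with rfl | ⟨h1, rfl⟩ | ⟨h1, rfl⟩
      · exact (G.twoCopies_adj_lo_lo r).2 hadj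
      · exact (G.twoCopies_adj_lo_hi r).2 ⟨hadj, h1⟩
      · exact (G.twoCopies_adj_lo_hi r).2 ⟨hadj.symm, h1⟩

/-- Since `r` holds in at most one direction along an edge, each edge gains at most one cross copy.
This is the source of the bound 2m. -/
lemma length_flatMap_copies_le {l : List (Fin n × Fin n)}
    (hr : ∀ p ∈ l, ¬ (r p.1 p.2 ∧ r p.2 p.1)) :
    (l.flatMap (copies r)).length ≤ 2 * l.length := by
  induction l with
  | nil => simp
  | cons p l ih =>
    have h1 : (copies r p).length ≤ 2 := by
      have := hr p (by simp)
      unfold copies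
      split_ifs <;> simp_all
    have h2 := ih fun q hq => hr q (by simp [hq])
    simp only [List.flatMap_cons, List.length_append, List.length_cons]
    omega

/-- Every edge survives in the first copy and every copy keeps its weight, so the two graphs have
the same set of weights. -/
lemma ratio_twoCopies : (G.twoCopies r).ratio = G.ratio := by
  have himg : (G.twoCopies r).weight '' (G.twoCopies r).graph.edgeSet =
      G.weight '' G.graph.edgeSet := by
    ext w
    constructor
    · rintro ⟨e, he, rfl⟩
      exact ⟨_, G.map_proj_mem_edgeSet he, (G.twoCopies_weight r he).symm⟩
    · rintro ⟨e, he, rfl⟩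
      induction e using Sym2.ind with
      | _ a b => exact ⟨s(lo a, lo b), (G.twoCopies_adj_lo_lo r).2 he, G.twoCopies_weight_lo_lo r he⟩
  have hzero : ∀ {k : ℕ} (H : WGraph k), H.numEdges = 0 ↔ H.weight '' H.graph.edgeSet = ∅ := by
    intro k H
    rw [numEdges, Set.ncard_eq_zero (Set.toFinite _), Set.image_eq_empty]
  simp only [ratio, hzero, maxWeight, minWeight, himg]

end TwoCopies

end WGraph

/-! ### A separating family of tournaments -/

/-- The parity of `a / 2 ^ i` is binary digit `i` of `a`; halving strips the last digit in the
induction. -/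
lemma eq_of_forall_div_two_pow_mod_two (L : ℕ) : ∀ a b : ℕ, a < 2 ^ L → b < 2 ^ L →
    (∀ i < L, (a / 2 ^ i % 2 = 0 ↔ b / 2 ^ i % 2 = 0)) → a = b := by
  induction L with
  | zero => intro a b ha hb _; simp at ha hb; omega
  | succ L ih =>
    intro a b ha hb h
    have h0 := h 0 (by omega)
    have := ih (a / 2) (b / 2) (by omega) (by omega) fun i hi => by
      have := h (i + 1) (by omega)
      rwa [pow_succ', ← Nat.div_div_eq_div_mul, ← Nat.div_div_eq_div_mul] at this
    simp at h0
    omega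

/-- Complementary digits add up to a string of L ones. -/
lemma add_add_one_of_forall_div_two_pow_mod_two (L : ℕ) : ∀ a b : ℕ, a < 2 ^ L → b < 2 ^ L →
    (∀ i < L, (a / 2 ^ i % 2 = 0 ↔ ¬ b / 2 ^ i % 2 = 0)) → a + b + 1 = 2 ^ L := by
  induction L with
  | zero => intro a b ha hb _; simp at ha hb; simp [ha, hb]
  | succ L ih =>
    intro a b ha hb h
    have h0 := h 0 (by omega)
    have := ih (a / 2) (b / 2) (by omega) (by omega) fun i hi => by
      have := h (i + 1) (by omega)
      rwa [pow_succ', ← Nat.div_div_eq_div_mul, ← Nat.div_div_eq_div_mul] at this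
    simp at h0
    omega

/-- The `i`-th tournament: an arc from `u` to `v`. -/
def orient (i u v : ℕ) : Prop :=
  if u < v then (v - u - 1) / 2 ^ i % 2 = 0 else ¬ (u - v - 1) / 2 ^ i % 2 = 0

lemma orient_swap (i : ℕ) {u v : ℕ} (h : u ≠ v) : orient i v u ↔ ¬ orient i u v := by
  unfold orient
  rcases Nat.lt_or_gt_of_ne h with h | h <;> simp [h, Nat.not_lt.2 h.le]

/-- Two arcs with a common end are oriented differently by one of the tournaments. -/
lemma exists_orient {n L u v z : ℕ} (hL : n ≤ 2 ^ L) (hu : u < n) (hv : v < n) (hz : z < n)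
    (huv : u ≠ v) (huz : u ≠ z) (hvz : v ≠ z) :
    ∃ i < L, (orient i u z ∧ ¬ orient i v z) ∨ (orient i v z ∧ ¬ orient i u z) := by
  by_contra hc
  push Not at hc
  have h : ∀ i < L, (orient i u z ↔ orient i v z) := fun i hi => by
    have := hc i hi
    tauto
  unfold orient at h
  -- If u and v lie on the same side of z, equal digits give equal differences and u = v. On
  -- opposite sides `orient` negates the digit once, so the digits are complementary and |u - v| = 2
  -- ^ L + 1, which is impossible below n.
  rcases Nat.lt_or_gt_of_ne huz with h1 | h1 <;> rcases Nat.lt_or_gt_of_ne hvz with h2 | h2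
  · simp only [h1, h2, if_true] at h
    have := eq_of_forall_div_two_pow_mod_two L _ _ (by omega) (by omega) h
    omega
  · simp only [h1, Nat.not_lt.2 h2.le, if_true, if_false] at h
    have := add_add_one_of_forall_div_two_pow_mod_two L _ _ (by omega) (by omega) h
    omega
  · simp only [h2, Nat.not_lt.2 h1.le, if_true, if_false] at h
    have := add_add_one_of_forall_div_two_pow_mod_two L _ _ (by omega) (by omega)
      fun i hi => (h i hi).symm
    omega
  · simp only [Nat.not_lt.2 h1.le, Nat.not_lt.2 h2.le, if_false, not_iff_not] at h
    have := eq_of_forall_div_two_pow_mod_two L _ _ (by omega) (by omega) h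
    omega

/-! ### What a program may change -/

namespace Prog

/-- The program may change integer register `x`. -/
def writesI (x : ℕ) : Prog → Bool
  | .setI y _ => x == y
  | .seq c d | .ite _ c d => c.writesI x || d.writesI x
  | .while _ c | .call c _ => c.writesI x
  | _ => false

/-- The program may change weight register `x`. -/
def writesW (x : ℕ) : Prog → Bool
  | .setW y _ => x == y
  | .seq c d | .ite _ c d => c.writesW x || d.writesW x
  | .while _ c | .call c _ => c.writesW x
  | _ => false

/-- The program may change integer array `a`. -/
def writesIArr (a : ℕ) : Prog → Bool
  | .putI b _ _ _ => a == b
  | .seq c d | .ite _ c d => c.writesIArr a || d.writesIArr a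
  | .while _ c | .call c _ => c.writesIArr a
  | _ => false

/-- The program may change weight array `a`. -/
def writesWArr (a : ℕ) : Prog → Bool
  | .putW b _ _ _ => a == b
  | .seq c d | .ite _ c d => c.writesWArr a || d.writesWArr a
  | .while _ c => c.writesWArr a
  | .call c _ => c.writesWArr a || a == answerArray
  | _ => false

end Prog

/-- The states `s` and `s'` agree in everything that `c` cannot change, except for the query. -/
structure Frame (c : Prog) (s s' : State) : Prop where
  ireg : ∀ x, c.writesI x = false → s'.ireg x = s.ireg x
  wreg : ∀ x, c.writesW x = false → s'.wreg x = s.wreg x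
  iarr : ∀ a, c.writesIArr a = false → s'.iarr a = s.iarr a
  warr : ∀ a, c.writesWArr a = false → s'.warr a = s.warr a

lemma Frame.refl (c : Prog) (s : State) : Frame c s s :=
  ⟨fun _ _ => rfl, fun _ _ => rfl, fun _ _ => rfl, fun _ _ => rfl⟩

lemma Frame.trans {c : Prog} {s s' s'' : State} (h : Frame c s s') (h' : Frame c s' s'') :
    Frame c s s'' :=
  ⟨fun x hx => (h'.ireg x hx).trans (h.ireg x hx), fun x hx => (h'.wreg x hx).trans (h.wreg x hx),
    fun x hx => (h'.iarr x hx).trans (h.iarr x hx), fun x hx => (h'.warr x hx).trans (h.warr x hx)⟩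

/-- `d` changes at most what `c` changes. -/
structure Prog.WritesLE (d c : Prog) : Prop where
  ireg : ∀ x, c.writesI x = false → d.writesI x = false
  wreg : ∀ x, c.writesW x = false → d.writesW x = false
  iarr : ∀ a, c.writesIArr a = false → d.writesIArr a = false
  warr : ∀ a, c.writesWArr a = false → d.writesWArr a = false

lemma Frame.mono {c d : Prog} {s s' : State} (h : Frame d s s') (hdc : d.WritesLE c) :
    Frame c s s' :=
  ⟨fun x hx => h.ireg x (hdc.ireg x hx), fun x hx => h.wreg x (hdc.wreg x hx),
    fun x hx => h.iarr x (hdc.iarr x hx), fun x hx => h.warr x (hdc.warr x hx)⟩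

lemma Prog.writesLE_seq_left (c d : Prog) : c.WritesLE (.seq c d) := by
  constructor <;> intro x hx <;>
    simp_all [Prog.writesI, Prog.writesW, Prog.writesIArr, Prog.writesWArr]

lemma Prog.writesLE_seq_right (c d : Prog) : d.WritesLE (.seq c d) := by
  constructor <;> intro x hx <;>
    simp_all [Prog.writesI, Prog.writesW, Prog.writesIArr, Prog.writesWArr]

lemma Prog.writesLE_ite_left (b : Test) (c d : Prog) : c.WritesLE (.ite b c d) := by
  constructor <;> intro x hx <;>
    simp_all [Prog.writesI, Prog.writesW, Prog.writesIArr, Prog.writesWArr]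

lemma Prog.writesLE_ite_right (b : Test) (c d : Prog) : d.WritesLE (.ite b c d) := by
  constructor <;> intro x hx <;>
    simp_all [Prog.writesI, Prog.writesW, Prog.writesIArr, Prog.writesWArr]

lemma Prog.writesLE_while (b : Test) (c : Prog) : c.WritesLE (.while b c) := by
  constructor <;> intro x hx <;>
    simp_all [Prog.writesI, Prog.writesW, Prog.writesIArr, Prog.writesWArr]

/-- For a concrete program the `writes` conditions are decided by evaluation, so later proofs
discharge them by `rfl` and invariants need not mention untouched memory. -/
lemma Run.frame {Q : GraphProblem} {c : Prog} {s s' : State} {t : ℕ} {q : List Call}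
    (h : Run Q c s s' t q) : Frame c s s' := by
  induction h with
  | skip => exact Frame.refl _ _
  | edge => exact ⟨fun _ _ => rfl, fun _ _ => rfl, fun _ _ => rfl, fun _ _ => rfl⟩
  | setI s x e =>
    refine ⟨fun y hy => ?_, fun _ _ => rfl, fun _ _ => rfl, fun _ _ => rfl⟩
    exact Function.update_of_ne (by simpa [Prog.writesI] using hy) _ _
  | setW s x e =>
    refine ⟨fun _ _ => rfl, fun y hy => ?_, fun _ _ => rfl, fun _ _ => rfl⟩
    exact Function.update_of_ne (by simpa [Prog.writesW] using hy) _ _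
  | putI s x e =>
    refine ⟨fun _ _ => rfl, fun _ _ => rfl, fun y hy => ?_, fun _ _ => rfl⟩
    exact Function.update_of_ne (by simpa [Prog.writesIArr] using hy) _ _
  | putW s x e =>
    refine ⟨fun _ _ => rfl, fun _ _ => rfl, fun _ _ => rfl, fun y hy => ?_⟩
    exact Function.update_of_ne (by simpa [Prog.writesWArr] using hy) _ _
  | seq _ _ ih1 ih2 =>
    exact (ih1.mono (Prog.writesLE_seq_left _ _)).trans (ih2.mono (Prog.writesLE_seq_right _ _))
  | iteTrue _ _ ih => exact ih.mono (Prog.writesLE_ite_left _ _ _)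
  | iteFalse _ _ ih => exact ih.mono (Prog.writesLE_ite_right _ _ _)
  | whileStop => exact Frame.refl _ _
  | whileStep _ _ _ ih1 ih2 => exact (ih1.mono (Prog.writesLE_while _ _)).trans ih2
  | call H l _ _ _ ih =>
    refine ⟨fun x hx => ih.ireg x hx, fun x hx => ih.wreg x hx, fun x hx => ih.iarr x hx,
      fun x hx => ?_⟩
    simp only [Prog.writesWArr, Bool.or_eq_false_iff, beq_eq_false_iff_ne] at hx
    exact (Function.update_of_ne hx.2 _ _).trans (ih.warr x hx.1)

/-! ### Program logic -/

/-- Started in `s`, the program stops within `T` steps and with at most `C` oracle calls, all of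
which satisfy `Φ`, in a state that satisfies `P`. -/
def Ensures (Q : GraphProblem) (c : Prog) (s : State) (T C : ℕ) (Φ : Call → Prop)
    (P : State → Prop) : Prop :=
  ∃ s' t q, Run Q c s s' t q ∧ t ≤ T ∧ q.length ≤ C ∧ (∀ x ∈ q, Φ x) ∧ P s'

namespace Ensures

variable {Q : GraphProblem} {c d : Prog} {s : State} {T T' C C' : ℕ} {Φ : Call → Prop}
  {P P' : State → Prop}

lemma mono (h : Ensures Q c s T C Φ P) (hT : T ≤ T') (hC : C ≤ C') (hP : ∀ s, P s → P' s) :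
    Ensures Q c s T' C' Φ P' := by
  obtain ⟨s', t, q, hr, ht, hq, hΦ, hs⟩ := h
  exact ⟨s', t, q, hr, ht.trans hT, hq.trans hC, hΦ, hP _ hs⟩

lemma post (h : Ensures Q c s T C Φ P) (hP : ∀ s', P s' → Frame c s s' → P' s') :
    Ensures Q c s T C Φ P' := by
  obtain ⟨s', t, q, hr, ht, hq, hΦ, hs⟩ := h
  exact ⟨s', t, q, hr, ht, hq, hΦ, hP _ hs hr.frame⟩

lemma seq (h : Ensures Q c s T C Φ fun s₁ => Ensures Q d s₁ T' C' Φ P) :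
    Ensures Q (.seq c d) s (T + T') (C + C') Φ P := by
  obtain ⟨s₁, t₁, q₁, hr₁, ht₁, hq₁, hΦ₁, s₂, t₂, q₂, hr₂, ht₂, hq₂, hΦ₂, hs⟩ := h
  refine ⟨s₂, _, _, .seq hr₁ hr₂, by omega, by simp; omega, ?_, hs⟩
  intro x hx
  rcases List.mem_append.1 hx with hx | hx
  exacts [hΦ₁ x hx, hΦ₂ x hx]

lemma seq' (h : Ensures Q c s T C Φ P')
    (h' : ∀ s', P' s' → Frame c s s' → Ensures Q d s' T' C' Φ P) :
    Ensures Q (.seq c d) s (T + T') (C + C') Φ P :=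
  seq (h.post h')

lemma skip (h : P s) : Ensures Q .skip s (T + 1) C Φ P :=
  ⟨_, _, _, .skip s, by omega, by simp, by simp, h⟩

lemma setI {x e} (h : P { s with ireg := Function.update s.ireg x (e.eval s) }) :
    Ensures Q (.setI x e) s (T + 1) C Φ P :=
  ⟨_, _, _, .setI s x e, by omega, by simp, by simp, h⟩

lemma setW {x e} (h : P { s with wreg := Function.update s.wreg x (e.eval s) }) :
    Ensures Q (.setW x e) s (T + 1) C Φ P :=
  ⟨_, _, _, .setW s x e, by omega, by simp, by simp, h⟩

lemma putI {a i j e}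
    (h : P { s with iarr := setEntry s.iarr a (i.eval s) (j.eval s) (e.eval s) }) :
    Ensures Q (.putI a i j e) s (T + 1) C Φ P :=
  ⟨_, _, _, .putI s a i j e, by omega, by simp, by simp, h⟩

lemma putW {a i j e}
    (h : P { s with warr := setEntry s.warr a (i.eval s) (j.eval s) (e.eval s) }) :
    Ensures Q (.putW a i j e) s (T + 1) C Φ P :=
  ⟨_, _, _, .putW s a i j e, by omega, by simp, by simp, h⟩

lemma edge {u v w} (h : P { s with query := s.query ++ [(u.eval s, v.eval s, w.eval s)] }) :
    Ensures Q (.edge u v w) s (T + 1) C Φ P :=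
  ⟨_, _, _, .edge s u v w, by omega, by simp, by simp, h⟩

lemma ite {b} (h : b.Holds s → Ensures Q c s T C Φ P) (h' : ¬ b.Holds s → Ensures Q d s T C Φ P) :
    Ensures Q (.ite b c d) s (T + 1) C Φ P := by
  by_cases hb : b.Holds s
  · obtain ⟨s', t, q, hr, ht, hq, hΦ, hs⟩ := h hb
    exact ⟨s', _, q, .iteTrue hb hr, by omega, hq, hΦ, hs⟩
  · obtain ⟨s', t, q, hr, ht, hq, hΦ, hs⟩ := h' hb
    exact ⟨s', _, q, .iteFalse hb hr, by omega, hq, hΦ, hs⟩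

/-- The first command of a sequence is a single step. -/
lemma step (h : Ensures Q c s 1 0 Φ fun s₁ => Ensures Q d s₁ T C Φ P) :
    Ensures Q (.seq c d) s (T + 1) C Φ P :=
  (seq h).mono (by omega) (by omega) fun _ h => h

/-- The body runs exactly N times. Each round costs one test beside the body, and the final failing
test accounts for the last step. The frame is relative to the start of the loop, so `Inv` only has
to describe what the body changes. -/
lemma whileLoop {b : Test} (N : ℕ) (Inv : ℕ → State → Prop) (h0 : Inv 0 s)
    (hstep : ∀ i < N, ∀ s', Frame c s s' → Inv i s' →
      b.Holds s' ∧ Ensures Q c s' T C Φ (Inv (i + 1)))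
    (hend : ∀ s', Frame c s s' → Inv N s' → ¬ b.Holds s') :
    Ensures Q (.while b c) s (N * (T + 1) + 1) (N * C) Φ (Inv N) := by
  have key : ∀ k i, i + k = N → ∀ s', Frame c s s' → Inv i s' →
      Ensures Q (.while b c) s' (k * (T + 1) + 1) (k * C) Φ (Inv N) := by
    intro k
    induction k with
    | zero =>
      intro i hi s' hf hs
      obtain rfl : i = N := by omega
      exact ⟨s', _, _, .whileStop (hend s' hf hs), by omega, by simp, by simp, hs⟩
    | succ k ih =>
      intro i hi s' hf hs
      obtain ⟨hb, s₁, t₁, q₁, hr₁, ht₁, hq₁, hΦ₁, hs₁⟩ := hstep i (by omega) s' hf hs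
      obtain ⟨s₂, t₂, q₂, hr₂, ht₂, hq₂, hΦ₂, hs₂⟩ :=
        ih (i + 1) (by omega) s₁ (hf.trans hr₁.frame) hs₁
      refine ⟨s₂, _, _, .whileStep hb hr₁ hr₂, ?_, ?_, ?_, hs₂⟩
      · rw [Nat.succ_mul]; omega
      · rw [List.length_append, Nat.succ_mul]; omega
      · intro x hx
        rcases List.mem_append.1 hx with hx | hx
        exacts [hΦ₁ x hx, hΦ₂ x hx]
  exact key N 0 (by omega) s (Frame.refl _ _) h0

/-- The time `T` of writing the query is recorded in the call and passed to `Φ`, not charged to the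
run; the call itself is one step. -/
lemma call {k : IExp} {N : ℕ} (H : WGraph N) (l : List (Fin N × Fin N)) (hl : H.IsEdgeList l)
    (h : Ensures Q c { s with query := [] } T 0 Φ fun s₁ => s₁.query = H.encode l ∧ k.eval s₁ = N ∧
      P { s₁ with warr := Function.update s₁.warr answerArray (Q.table H), query := [] })
    (hΦ : ∀ t ≤ T, Φ ⟨N, H, t⟩) :
    Ensures Q (.call c k) s (T' + 1) (C + 1) Φ P := by
  obtain ⟨s₁, t, q, hr, ht, hq, -, hs, hk, hP⟩ := h
  obtain rfl : q = [] := by simpa using hq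
  subst hk
  exact ⟨_, _, _, .call H l hr hl hs, by omega, by simp, by simpa using hΦ t ht, hP⟩

end Ensures

/-- `for x < b do c`, where the bound is in register `b`. -/
def forLoop (x b : ℕ) (c : Prog) : Prog :=
  .seq (.setI x (.lit 0)) (.while (.ilt (.reg x) (.reg b)) (.seq c (.setI x (.succ (.reg x)))))

/-- `for y < n, z < n do c`, with `y`, `z`, `n` in registers `2`, `3`, `0`. -/
def forLoop₂ (c : Prog) : Prog := forLoop 2 0 (forLoop 3 0 c)

lemma writesLE_forLoop (x b : ℕ) (c : Prog) : c.WritesLE (forLoop x b c) := by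
  constructor <;> intro x hx <;>
    simp_all [forLoop, Prog.writesI, Prog.writesW, Prog.writesIArr, Prog.writesWArr]

lemma writesLE_forLoop_setI (x b : ℕ) (e : IExp) (c : Prog) :
    (Prog.setI x e).WritesLE (forLoop x b c) := by
  constructor <;> intro x hx <;>
    simp_all [forLoop, Prog.writesI, Prog.writesW, Prog.writesIArr, Prog.writesWArr]

namespace Ensures

variable {Q : GraphProblem} {c : Prog} {s : State} {T : ℕ} {Φ : Call → Prop}

/-- A round costs the body, a test and an increment; initialisation and the last test add 2. `hInv`
lets the invariant survive changes of the counter. -/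
lemma forLoop {x b N : ℕ} (hx : c.writesI x = false) (hb : c.writesI b = false) (hxb : b ≠ x)
    (hN : s.ireg b = N) (Inv : ℕ → State → Prop)
    (hInv : ∀ i s f, Inv i s → Inv i { s with ireg := f }) (h0 : Inv 0 s)
    (hstep : ∀ i < N, ∀ s', Frame (forLoop x b c) s s' → s'.ireg x = i → Inv i s' →
      Ensures Q c s' T 0 Φ (Inv (i + 1))) :
    Ensures Q (SparseReduction.forLoop x b c) s (N * (T + 2) + 2) 0 Φ (Inv N) := by
  have hset : ∀ (s : State) e, Frame (SparseReduction.forLoop x b c) s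
      { s with ireg := Function.update s.ireg x e } := fun s e =>
    (Run.setI (Q := Q) s x (.lit e)).frame.mono (writesLE_forLoop_setI x b _ c)
  have hbf : (SparseReduction.forLoop x b c).writesI b = false := by
    simp [SparseReduction.forLoop, Prog.writesI, hb, hxb]
  refine (step (T := N * (T + 2) + 1) (setI ?_)).mono (by omega) le_rfl fun _ h => h
  refine (whileLoop (T := T + 1) (C := 0) N (fun i s' => Inv i s' ∧ s'.ireg x = i ∧
    Frame (SparseReduction.forLoop x b c) s s') ?_ ?_ ?_).mono le_rfl (by simp)
    fun _ h => h.1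
  · exact ⟨hInv _ _ _ h0, by simp [IExp.eval], hset _ _⟩
  · rintro i hi s' - ⟨hs, hsx, hf⟩
    have hsb : s'.ireg b = N := (hf.ireg b hbf).trans hN
    refine ⟨by simpa [Test.Holds, IExp.eval, hsx, hsb] using hi, ?_⟩
    refine (seq' (T := T) (T' := 1) (C := 0) (C' := 0) (P' := Inv (i + 1))
      (hstep i hi s' hf hsx hs) fun s₁ h₁ hf₁ => setI ?_)
    refine ⟨hInv _ _ _ h₁, ?_, (hf.trans (hf₁.mono (writesLE_forLoop x b c))).trans (hset _ _)⟩
    simp [IExp.eval, hf₁.ireg x hx, hsx]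
  · rintro s' - ⟨-, hsx, hf⟩
    have hsb : s'.ireg b = N := (hf.ireg b hbf).trans hN
    simp [Test.Holds, IExp.eval, hsx, hsb]

/-- Cells are visited in lexicographic order: visited cells satisfy `Post`, the others still satisfy
`Pre`, and `J` is global. A step may rely on `Post` at all earlier cells, as needed for tables
defined by recursion. -/
lemma forLoop₂ {n : ℕ} (hc : c.writesI 2 = false ∧ c.writesI 3 = false ∧ c.writesI 0 = false)
    (hn : s.ireg 0 = n) (J : State → Prop) (Pre Post : ℕ → ℕ → State → Prop)
    (hJ : ∀ s f, J s → J { s with ireg := f })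
    (hPre : ∀ y z s f, Pre y z s → Pre y z { s with ireg := f })
    (hPost : ∀ y z s f, Post y z s → Post y z { s with ireg := f })
    (h0 : J s) (hpre0 : ∀ y < n, ∀ z < n, Pre y z s)
    (hstep : ∀ y < n, ∀ z < n, ∀ s', Frame (forLoop₂ c) s s' → s'.ireg 2 = y → s'.ireg 3 = z →
      J s' → Pre y z s' → (∀ y' < n, ∀ z' < n, y' < y ∨ y' = y ∧ z' < z → Post y' z' s') →
      Ensures Q c s' T 0 Φ fun s₁ => J s₁ ∧ Post y z s₁ ∧ ∀ y' z', ¬ (y' = y ∧ z' = z) →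
        (Pre y' z' s' → Pre y' z' s₁) ∧ (Post y' z' s' → Post y' z' s₁)) :
    Ensures Q (SparseReduction.forLoop₂ c) s (n * (n * (T + 2) + 4) + 2) 0 Φ
      fun s' => J s' ∧ ∀ y < n, ∀ z < n, Post y z s' := by
  have hle : (SparseReduction.forLoop 3 0 c).WritesLE (SparseReduction.forLoop₂ c) :=
    writesLE_forLoop _ _ _
  let Inv : ℕ → ℕ → State → Prop := fun y z s => J s ∧ ∀ y' < n, ∀ z' < n,
    (y' < y ∨ y' = y ∧ z' < z → Post y' z' s) ∧ (¬ (y' < y ∨ y' = y ∧ z' < z) → Pre y' z' s)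
  have hInv : ∀ y z s f, Inv y z s → Inv y z { s with ireg := f } := fun y z s f h =>
    ⟨hJ _ _ h.1, fun y' hy z' hz => ⟨fun hlt => hPost _ _ _ _ ((h.2 y' hy z' hz).1 hlt),
      fun hlt => hPre _ _ _ _ ((h.2 y' hy z' hz).2 hlt)⟩⟩
  refine (forLoop (T := n * (T + 2) + 2) ?_ ?_ (by decide) hn (fun y => Inv y 0)
    (fun y => hInv y 0) ⟨h0, fun y' hy z' hz => ⟨by omega, fun _ => hpre0 y' hy z' hz⟩⟩ ?_).mono
    (by ring_nf; omega) le_rfl fun s' h => ⟨h.1, fun y hy z hz => (h.2 y hy z hz).1 (by omega)⟩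
  · simp [SparseReduction.forLoop, Prog.writesI, hc.1]
  · simp [SparseReduction.forLoop, Prog.writesI, hc.2.2]
  intro y hy s₁ hf₁ hy₁ h₁
  refine (forLoop (T := T) hc.2.1 hc.2.2 (by decide) (N := n) ?_ (fun z => Inv y z)
    (fun z => hInv y z) h₁ ?_).mono le_rfl le_rfl fun s' h => ⟨h.1, fun y' hy' z' hz' => ?_⟩
  · rw [hf₁.ireg 0 (by simp [SparseReduction.forLoop, Prog.writesI, hc.2.2]), hn]
  · intro z hz s₂ hf₂ hz₂ h₂
    have hy₂ : s₂.ireg 2 = y := by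
      rw [hf₂.ireg 2 (by simp [SparseReduction.forLoop, Prog.writesI, hc.1]), hy₁]
    refine (hstep y hy z hz s₂ (Frame.trans hf₁ (hf₂.mono hle)) hy₂ hz₂ h₂.1
      ((h₂.2 y hy z hz).2 (by omega)) fun y' hy' z' hz' hlt => (h₂.2 y' hy' z' hz').1 hlt).mono
      le_rfl le_rfl fun s₃ h₃ => ⟨h₃.1, fun y' hy' z' hz' => ?_⟩
    by_cases heq : y' = y ∧ z' = z
    · obtain ⟨rfl, rfl⟩ := heq
      exact ⟨fun _ => h₃.2.1, fun hlt => absurd (Or.inr ⟨rfl, by omega⟩) hlt⟩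
    · exact ⟨fun hlt => (h₃.2.2 y' z' heq).2 ((h₂.2 y' hy' z' hz').1 (by omega)),
        fun hlt => (h₃.2.2 y' z' heq).1 ((h₂.2 y' hy' z' hz').2 (by omega))⟩
  · exact ⟨fun hlt => (h.2 y' hy' z' hz').1 (by omega), fun hlt => (h.2 y' hy' z' hz').2 (by omega)⟩

end Ensures

/-! ### The program

Registers and arrays: the registers `0`, `1` hold the numbers of nodes and edges, `2`, `3` are loop
counters and `5` controls the main loop; the weight registers `0`, `1`, `2` hold the smallest and the
largest edge weight and the current scale. The integer arrays are: `0` the edges, `1` parities, `2`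
halves, `3` the shifted index differences, `4` the second copies of the nodes. The weight
arrays `3` and `4` hold the candidates for the two sides of the current tournament. -/

/-- The `j`-th endpoint of the current edge. -/
def edgeEnd (j : ℕ) : IExp := .get 0 (.reg 2) (.lit j)

/-- The weight of the current edge. -/
def edgeWeight : WExp := .get 0 (.reg 2) (.lit 0)

/-- The entry of `u`, `v` in the table of shifted differences is even. -/
def evenTest (u v : IExp) : Test := .ilt (.get 1 (.get 3 u v) (.lit 0)) (.lit 1)

/-- The current tournament has an arc from the first to the second end of the current edge. -/
def arcTest : Test :=
  .not (.and (.not (.and (.ilt (edgeEnd 0) (edgeEnd 1)) (evenTest (edgeEnd 0) (edgeEnd 1))))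
    (.not (.and (.not (.ilt (edgeEnd 0) (edgeEnd 1)))
      (.not (evenTest (edgeEnd 1) (edgeEnd 0))))))

/-- The second copy of a node. -/
def secondCopy (u : IExp) : IExp := .get 4 u (.lit 0)

/-- Write the edges of the two copy graph. -/
def buildQuery (o : Test) : Prog :=
  forLoop 2 1 (.seq (.edge (edgeEnd 0) (edgeEnd 1) edgeWeight)
    (.ite (.and (.not (.wlt edgeWeight (.reg 2))) (.wlt edgeWeight (.add (.reg 2) (.reg 2))))
      (.ite o (.edge (edgeEnd 0) (secondCopy (edgeEnd 1)) edgeWeight)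
        (.edge (edgeEnd 1) (secondCopy (edgeEnd 0)) edgeWeight))
      .skip))

/-- The distance to the second copy. -/
def crossDist : WExp := .get 1 (.reg 2) (secondCopy (.reg 3))

/-- Update the candidates in array `a` by the answers of the oracle. -/
def relax (a : ℕ) : Prog :=
  forLoop₂ (.ite (.and
      (.wlt crossDist (.add (.get 1 (.reg 2) (.reg 3)) (.add (.reg 2) (.reg 2))))
      (.wlt crossDist (.get a (.reg 2) (.reg 3))))
    (.putW a (.reg 2) (.reg 3) crossDist) .skip)

/-- Ask the oracle about one two copy graph and update the candidates. -/
def askAndRelax (o : Test) (a : ℕ) : Prog :=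
  .seq (.call (buildQuery o) (secondCopy (.reg 0))) (relax a)

/-- Process the current scale and double it. -/
def scaleStep : Prog :=
  .seq (askAndRelax arcTest 3) (.seq (askAndRelax (.not arcTest) 4)
    (.setW 2 (.add (.reg 2) (.reg 2))))

/-- The sum of the two candidates. -/
def candidateSum : WExp := .add (.get 3 (.reg 2) (.reg 3)) (.get 4 (.reg 2) (.reg 3))

/-- Update the output, halve the table of shifted differences and clear the candidates. -/
def collect : Prog :=
  forLoop₂ (.seq
    (.ite (.wlt candidateSum (.get outputArray (.lit 0) (.lit 0)))
      (.putW outputArray (.lit 0) (.lit 0) candidateSum) .skip)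
    (.seq (.putI 3 (.reg 2) (.reg 3) (.get 2 (.get 3 (.reg 2) (.reg 3)) (.lit 0)))
      (.seq (.putW 3 (.reg 2) (.reg 3) .top) (.putW 4 (.reg 2) (.reg 3) .top))))

/-- All scales for the current tournament. -/
def tournamentStep : Prog :=
  .seq (.setW 2 (.reg 0)) (.seq (.while (.not (.wlt (.reg 1) (.reg 2))) scaleStep)
    (.seq collect (.setI 5 (.get 2 (.reg 5) (.lit 0)))))

/-- Tables of parities, halves and second copies. -/
def prepareTables : Prog :=
  .seq (.putI 1 (.lit 1) (.lit 0) (.lit 1)) (.seq (.putI 4 (.lit 0) (.lit 0) (.reg 0))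
    (forLoop 2 0 (.seq
      (.putI 1 (.succ (.succ (.reg 2))) (.lit 0) (.get 1 (.reg 2) (.lit 0)))
      (.seq (.putI 2 (.succ (.succ (.reg 2))) (.lit 0) (.succ (.get 2 (.reg 2) (.lit 0))))
        (.putI 4 (.succ (.reg 2)) (.lit 0) (.succ (.get 4 (.reg 2) (.lit 0))))))))

/-- The table of shifted differences, and empty candidates. -/
def prepareDifferences : Prog :=
  forLoop₂ (.seq (.ite (.ilt (.lit 0) (.reg 2))
      (.putI 3 (.reg 2) (.reg 3) (.pred (.get 3 (.pred (.reg 2)) (.reg 3))))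
      (.putI 3 (.reg 2) (.reg 3) (.pred (.reg 3))))
    (.seq (.putW 3 (.reg 2) (.reg 3) .top) (.putW 4 (.reg 2) (.reg 3) .top)))

/-- The smallest and the largest edge weight. -/
def prepareExtremes : Prog :=
  .seq (.setW 0 .top) (forLoop 2 1 (.seq
    (.ite (.wlt edgeWeight (.reg 0)) (.setW 0 edgeWeight) .skip)
    (.ite (.wlt (.reg 1) edgeWeight) (.setW 1 edgeWeight) .skip)))

/-- Everything before the main loop. -/
def prepare : Prog :=
  .seq prepareTables (.seq prepareDifferences (.seq prepareExtremes
    (.seq (.putW outputArray (.lit 0) (.lit 0) .top) (.setI 5 (.pred (.reg 0))))))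

/-- The reduction. -/
def mwcProgram : Prog := .seq prepare (.while (.ilt (.lit 0) (.reg 5)) tournamentStep)

@[simp] lemma setEntry_apply {α : Type} (f : ℕ → ℕ → ℕ → α) (a i j : ℕ) (v : α) (a' i' j' : ℕ) :
    setEntry f a i j v a' i' j' = if a' = a ∧ i' = i ∧ j' = j then v else f a' i' j' := by
  unfold setEntry
  by_cases ha : a' = a <;> by_cases hi : i' = i <;> by_cases hj : j' = j <;>
    simp [ha, hi, hj]

/-! ### Preparation -/

variable {n : ℕ}

/-- The edge weight of a pair. -/
abbrev WGraph.pairWeight (G : WGraph n) (p : Fin n × Fin n) : ℝ≥0∞ := G.weight s(p.1, p.2)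

/-- `a` and `b` are the smallest and the largest weight of the pairs in `l`, with `∞` and `0` for
the empty list. -/
structure IsExtremes (G : WGraph n) (l : List (Fin n × Fin n)) (a b : ℝ≥0∞) : Prop where
  le : ∀ p ∈ l, a ≤ G.pairWeight p
  eq : a = ⊤ ∧ l = [] ∨ ∃ p ∈ l, a = G.pairWeight p
  ge : ∀ p ∈ l, G.pairWeight p ≤ b
  eq' : b = 0 ∨ ∃ p ∈ l, b = G.pairWeight p

/-- The content of the read only part of the memory during the main loop. -/
structure Prepared (G : WGraph n) (l : List (Fin n × Fin n)) (a b : ℝ≥0∞) (s : State) : Prop where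
  nodes : s.ireg 0 = n
  edges : s.ireg 1 = l.length
  ends : s.iarr 0 = (initState G l).iarr 0
  weights : s.warr 0 = (initState G l).warr 0
  parity : ∀ d ≤ n, s.iarr 1 d 0 = d % 2
  half : ∀ d ≤ n, s.iarr 2 d 0 = d / 2
  second : ∀ d ≤ n, s.iarr 4 d 0 = n + d
  minimum : s.wreg 0 = a
  maximum : s.wreg 1 = b

lemma Prepared.of_frame {G : WGraph n} {l : List (Fin n × Fin n)} {a b : ℝ≥0∞} {s s' : State}
    {c : Prog} (h : Prepared G l a b s) (hf : Frame c s s')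
    (h1 : c.writesI 0 = false ∧ c.writesI 1 = false ∧ c.writesIArr 0 = false ∧
      c.writesWArr 0 = false ∧ c.writesIArr 1 = false ∧ c.writesIArr 2 = false ∧
      c.writesIArr 4 = false ∧ c.writesW 0 = false ∧ c.writesW 1 = false) :
    Prepared G l a b s' := by
  obtain ⟨h0, h1, h2, h3, h4, h5, h6, h7, h8⟩ := h1
  constructor
  · rw [hf.ireg 0 h0, h.nodes]
  · rw [hf.ireg 1 h1, h.edges]
  · rw [hf.iarr 0 h2, h.ends]
  · rw [hf.warr 0 h3, h.weights]
  · rw [hf.iarr 1 h4]; exact h.parity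
  · rw [hf.iarr 2 h5]; exact h.half
  · rw [hf.iarr 4 h6]; exact h.second
  · rw [hf.wreg 0 h7, h.minimum]
  · rw [hf.wreg 1 h8, h.maximum]

section Reading

variable {G : WGraph n} {l : List (Fin n × Fin n)} {s : State} {e : ℕ}

lemma encode_getD (he : e < l.length) :
    (G.encode l).getD e (0, 0, 0) = ((l[e].1 : ℕ), (l[e].2 : ℕ), G.pairWeight l[e]) := by
  simp [WGraph.encode, he]

lemma eval_edgeEnd_zero (hs : s.iarr 0 = (initState G l).iarr 0) (h2 : s.ireg 2 = e)
    (he : e < l.length) : (edgeEnd 0).eval s = l[e].1 := by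
  simp only [edgeEnd, IExp.eval, h2, hs, initState, encode_getD he]
  simp

lemma eval_edgeEnd_one (hs : s.iarr 0 = (initState G l).iarr 0) (h2 : s.ireg 2 = e)
    (he : e < l.length) : (edgeEnd 1).eval s = l[e].2 := by
  simp only [edgeEnd, IExp.eval, h2, hs, initState, encode_getD he]
  simp

lemma eval_edgeWeight (hs : s.warr 0 = (initState G l).warr 0) (h2 : s.ireg 2 = e)
    (he : e < l.length) : edgeWeight.eval s = G.pairWeight l[e] := by
  simp only [edgeWeight, IExp.eval, WExp.eval, h2, hs, initState, encode_getD he]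
  simp

end Reading

/-- The machine can neither divide nor add integers, so parities and halves are filled in by
recursion from d to d + 2, and n + d by recursion from d to d + 1. The remaining starting values are
the initial zeros of the arrays. -/
lemma ensures_prepareTables {Q : GraphProblem} {Φ : Call → Prop} {s : State}
    (hn : s.ireg 0 = n) (h1 : ∀ d, s.iarr 1 d 0 = 0) (h2 : ∀ d, s.iarr 2 d 0 = 0) :
    Ensures Q prepareTables s (n * 5 + 2 + 2) 0 Φ fun s' =>
      (∀ d ≤ n, s'.iarr 1 d 0 = d % 2) ∧ (∀ d ≤ n, s'.iarr 2 d 0 = d / 2) ∧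
      ∀ d ≤ n, s'.iarr 4 d 0 = n + d := by
  refine Ensures.step (Ensures.putI (Ensures.step (Ensures.putI ?_)))
  refine (Ensures.forLoop (T := 3) (N := n) rfl rfl (by decide) ?_ (fun i s =>
    (∀ d < i + 2, s.iarr 1 d 0 = d % 2) ∧ (∀ d < i + 2, s.iarr 2 d 0 = d / 2) ∧
      ∀ d < i + 1, s.iarr 4 d 0 = n + d) (fun _ _ _ h => h) ?_ ?_).mono le_rfl le_rfl ?_
  · simpa [IExp.eval] using hn
  · simp only [IExp.eval, setEntry_apply]
    refine ⟨fun d hd => ?_, fun d hd => ?_, fun d hd => ?_⟩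
    · obtain rfl | rfl : d = 0 ∨ d = 1 := by omega
      · simp [h1]
      · simp
    · obtain rfl | rfl : d = 0 ∨ d = 1 := by omega
      · simp [h2]
      · simp [h2]
    · obtain rfl : d = 0 := by omega
      simp [hn]
  · rintro i hi s' - hx ⟨ha, hb, hc⟩
    refine Ensures.step (Ensures.putI (Ensures.step (Ensures.putI (Ensures.putI ?_))))
    simp only [IExp.eval, setEntry_apply, hx]
    refine ⟨fun d hd => ?_, fun d hd => ?_, fun d hd => ?_⟩
    · by_cases h : d = i + 1 + 1
      · subst h
        have := ha i (by omega)
        simp [this]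
        omega
      · simpa [h] using ha d (by omega)
    · by_cases h : d = i + 1 + 1
      · subst h
        have := hb i (by omega)
        simp [this]
        omega
      · simpa [h] using hb d (by omega)
    · by_cases h : d = i + 1
      · subst h
        have := hc i (by omega)
        simp [this]
        omega
      · simpa [h] using hc d (by omega)
  · exact fun s' h => ⟨fun d hd => h.1 d (by omega), fun d hd => h.2.1 d (by omega),
      fun d hd => h.2.2 d (by omega)⟩

/-- With truncated subtraction each row is the predecessor of the row above it. Entries with y ≥ z
are 0 and never decide `arcTest`. -/
lemma ensures_prepareDifferences {Q : GraphProblem} {Φ : Call → Prop} {s : State}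
    (hn : s.ireg 0 = n) :
    Ensures Q prepareDifferences s (n * (n * 6 + 4) + 2) 0 Φ fun s' =>
      ∀ y < n, ∀ z < n, s'.iarr 3 y z = z - y - 1 ∧ s'.warr 3 y z = ⊤ ∧ s'.warr 4 y z = ⊤ := by
  refine (Ensures.forLoop₂ (T := 4) ⟨rfl, rfl, rfl⟩ hn (fun _ => True) (fun _ _ _ => True)
    (fun y z s => s.iarr 3 y z = z - y - 1 ∧ s.warr 3 y z = ⊤ ∧ s.warr 4 y z = ⊤)
    (fun _ _ h => h) (fun _ _ _ _ h => h) (fun _ _ _ _ h => h) trivial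
    (fun _ _ _ _ => trivial) ?_).mono le_rfl le_rfl fun _ h => h.2
  intro y hy z hz s' _ h2 h3 _ _ hprev
  refine Ensures.seq (T := 2) (T' := 2) (C := 0) (C' := 0) (Ensures.ite ?_ ?_)
  · intro hpos
    simp only [Test.Holds, IExp.eval, h2] at hpos
    refine Ensures.putI (Ensures.step (Ensures.putW (Ensures.putW ?_)))
    have := (hprev (y - 1) (by omega) z hz (by omega)).1
    simp only [IExp.eval, WExp.eval, setEntry_apply, h2, h3, this]
    refine ⟨trivial, ?_, fun y' z' hne => ⟨fun _ => trivial, ?_⟩⟩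
    · simp
      omega
    · simp +contextual [hne]
  · intro hpos
    simp only [Test.Holds, IExp.eval, h2] at hpos
    refine Ensures.putI (Ensures.step (Ensures.putW (Ensures.putW ?_)))
    simp only [IExp.eval, WExp.eval, setEntry_apply, h2, h3]
    refine ⟨trivial, ?_, fun y' z' hne => ⟨fun _ => trivial, ?_⟩⟩
    · simp
      omega
    · simp +contextual [hne]

lemma ensures_prepareExtremes {Q : GraphProblem} {Φ : Call → Prop} {s : State} {G : WGraph n}
    {l : List (Fin n × Fin n)} (h1 : s.ireg 1 = l.length) (hw : s.warr 0 = (initState G l).warr 0)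
    (h0 : s.wreg 1 = 0) :
    Ensures Q prepareExtremes s (l.length * 6 + 2 + 1) 0 Φ fun s' =>
      IsExtremes G l (s'.wreg 0) (s'.wreg 1) := by
  refine Ensures.step (Ensures.setW ?_)
  refine Ensures.mono (Ensures.forLoop (T := 4) (N := l.length) (by rfl) (by rfl) (by decide)
    (by exact h1) (fun i s => IsExtremes G (l.take i) (s.wreg 0) (s.wreg 1)) (fun _ _ _ h => h)
    ?_ ?_) le_rfl le_rfl ?_
  · exact ⟨by simp, by simp [WExp.eval], by simp, by simp [h0]⟩
  · rintro i hi s' hf hx h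
    have hw' : s'.warr 0 = (initState G l).warr 0 := by rw [hf.warr 0 rfl]; exact hw
    have hev := eval_edgeWeight hw' hx hi
    have hmem : ∀ q, q ∈ l.take (i + 1) ↔ q ∈ l.take i ∨ q = l[i] := fun q => by
      rw [List.take_succ_eq_append_getElem hi, List.mem_append, List.mem_singleton]
    refine Ensures.seq' (T := 2) (T' := 2) (C := 0) (C' := 0) (P' := fun s =>
      s.wreg 1 = s'.wreg 1 ∧ s.warr 0 = s'.warr 0 ∧ s.ireg 2 = i ∧
      (∀ q ∈ l.take (i + 1), s.wreg 0 ≤ G.pairWeight q) ∧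
      ∃ q ∈ l.take (i + 1), s.wreg 0 = G.pairWeight q) (Ensures.ite ?_ ?_) ?_
    · intro hlt
      refine Ensures.setW ?_
      simp only [Test.Holds, WExp.eval, hev] at hlt
      refine ⟨by simp, rfl, hx, fun q hq => ?_, l[i], (hmem _).2 (Or.inr rfl), by simp [hev]⟩
      simp only [hev, Function.update_self]
      rcases (hmem q).1 hq with hq | rfl
      · exact hlt.le.trans (h.le q hq)
      · exact le_rfl
    · intro hlt
      refine Ensures.skip ?_
      simp only [Test.Holds, WExp.eval, hev, not_lt] at hlt
      refine ⟨rfl, rfl, hx, fun q hq => ?_, ?_⟩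
      · rcases (hmem q).1 hq with hq | rfl
        · exact h.le q hq
        · exact hlt
      -- The initial `∞` cannot survive a comparison with a finite edge weight.
      · rcases h.eq with ⟨ht, -⟩ | ⟨q, hq, he⟩
        · rw [ht] at hlt
          exact absurd hlt (by simp)
        · exact ⟨q, (hmem q).2 (Or.inl hq), he⟩
    · rintro s₁ ⟨ha, hb, hc, hd, he⟩ -
      have hev₁ := eval_edgeWeight (hb.trans hw') hc hi
      refine Ensures.ite ?_ ?_
      · intro hlt
        refine Ensures.setW ?_
        simp only [Test.Holds, WExp.eval, hev₁] at hlt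
        refine ⟨by simpa using hd, Or.inr (by simpa using he), fun q hq => ?_,
          Or.inr ⟨l[i], (hmem _).2 (Or.inr rfl), by simp [hev₁]⟩⟩
        simp only [hev₁, Function.update_self]
        rcases (hmem q).1 hq with hq | rfl
        · exact (h.ge q hq).trans (ha ▸ hlt.le)
        · exact le_rfl
      · intro hlt
        refine Ensures.skip ?_
        simp only [Test.Holds, WExp.eval, hev₁, not_lt] at hlt
        refine ⟨hd, Or.inr he, fun q hq => ?_, ?_⟩
        · rcases (hmem q).1 hq with hq | rfl
          · exact ha ▸ h.ge q hq
          · exact hlt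
        · rw [ha]
          exact h.eq'.imp id fun ⟨q, hq, he⟩ => ⟨q, (hmem q).2 (Or.inl hq), he⟩
  · intro s' h
    simpa using h

/-! ### Asking the oracle -/

open WGraph

/-- Arcs of `r` along edges with weight in `[a, 2a)`. -/
def scaleArcs (G : WGraph n) (r : Fin n → Fin n → Prop) (a : ℝ≥0∞) (u v : Fin n) : Prop :=
  r u v ∧ a ≤ G.weight s(u, v) ∧ (G.weight s(u, v) : ℝ≥0∞) < a + a

-- Exactly one direction of the edge is an arc of `r`, so an edge in the scale gets exactly one
-- cross copy; this matches the two-way branch in `buildQuery`.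
open Classical in
lemma encode_copies (G : WGraph n) {r : Fin n → Fin n → Prop} {a : ℝ≥0∞} {p : Fin n × Fin n}
    (hp : G.graph.Adj p.1 p.2) (hr : r p.2 p.1 ↔ ¬ r p.1 p.2) :
    (G.twoCopies (scaleArcs G r a)).encode (copies (scaleArcs G r a) p) =
      ((p.1 : ℕ), (p.2 : ℕ), (G.pairWeight p : ℝ≥0∞)) ::
        if a ≤ G.pairWeight p ∧ (G.pairWeight p : ℝ≥0∞) < a + a then
          if r p.1 p.2 then [((p.1 : ℕ), n + p.2, (G.pairWeight p : ℝ≥0∞))]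
          else [((p.2 : ℕ), n + p.1, (G.pairWeight p : ℝ≥0∞))]
        else [] := by
  have hw : G.weight s(p.2, p.1) = G.weight s(p.1, p.2) := by rw [Sym2.eq_swap]
  have h0 := G.twoCopies_weight_lo_lo (scaleArcs G r a) hp
  have h1 := fun h => G.twoCopies_weight_lo_hi (scaleArcs G r a) hp h
  have h2 := fun h => G.twoCopies_weight_lo_hi (scaleArcs G r a) hp.symm h
  unfold copies
  have e1 : scaleArcs G r a p.1 p.2 ↔
      r p.1 p.2 ∧ (a ≤ G.pairWeight p ∧ (G.pairWeight p : ℝ≥0∞) < a + a) := Iff.rfl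
  have e2 : scaleArcs G r a p.2 p.1 ↔
      ¬ r p.1 p.2 ∧ (a ≤ G.pairWeight p ∧ (G.pairWeight p : ℝ≥0∞) < a + a) := by
    unfold scaleArcs
    rw [hw, hr]
  rw [hw] at h2
  by_cases hc : a ≤ G.pairWeight p ∧ (G.pairWeight p : ℝ≥0∞) < a + a <;> by_cases hrp : r p.1 p.2
  · have h1' := h1 (e1.2 ⟨hrp, hc⟩)
    simp [encode, e1, e2, hc, hrp, h0, h1', coe_lo, coe_hi]
  · have h2' := h2 (e2.2 ⟨hrp, hc⟩)
    simp [encode, e1, e2, hc, hrp, h0, h2', coe_lo, coe_hi]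
  · simp only [e1, e2, hc, and_false, if_false]
    simp [encode, h0, coe_lo]
  · simp only [e1, e2, hc, and_false, if_false]
    simp [encode, h0, coe_lo]

/-- `o` evaluates the arcs `r` along the edges in the list `l`. -/
def TestsArc (o : Test) (r : Fin n → Fin n → Prop) (l : List (Fin n × Fin n)) (s : State) : Prop :=
  ∀ s' : State, s'.iarr = s.iarr → ∀ e (he : e < l.length), s'.ireg 2 = e →
    (o.Holds s' ↔ r l[e].1 l[e].2)

lemma iarr_eq_of_frame {c : Prog} {s s' : State} (h : Frame c s s')
    (hc : ∀ a, c.writesIArr a = false) : s'.iarr = s.iarr :=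
  funext fun a => h.iarr a (hc a)

lemma ensures_buildQuery {Q : GraphProblem} {Φ : Call → Prop} {s : State} {G : WGraph n}
    {l : List (Fin n × Fin n)} (hl : G.IsEdgeList l) {a b : ℝ≥0∞} (hs : Prepared G l a b s)
    {o : Test} {r : Fin n → Fin n → Prop} (hr : ∀ u v, u ≠ v → (r v u ↔ ¬ r u v))
    (ho : TestsArc o r l s) (hq : s.query = []) :
    Ensures Q (buildQuery o) s (l.length * 6 + 2) 0 Φ fun s' =>
      s'.query = (G.twoCopies (scaleArcs G r (s.wreg 2))).encode
        (l.flatMap (copies (scaleArcs G r (s.wreg 2)))) := by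
  refine Ensures.mono (Ensures.forLoop (T := 4) (N := l.length) (by rfl) (by rfl) (by decide)
    hs.edges (fun i s' => s'.query = (G.twoCopies (scaleArcs G r (s.wreg 2))).encode
        ((l.take i).flatMap (copies (scaleArcs G r (s.wreg 2))))) (fun _ _ _ h => h)
    (by simp [hq, encode]) ?_) le_rfl le_rfl (by simp)
  rintro i hi s' hf hx h
  have hs' : Prepared G l a b s' :=
    hs.of_frame hf (by refine ⟨?_, ?_, ?_, ?_, ?_, ?_, ?_, ?_, ?_⟩ <;> rfl)
  have hia : s'.iarr = s.iarr := iarr_eq_of_frame hf fun _ => rfl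
  have hw2 : s'.wreg 2 = s.wreg 2 := hf.wreg 2 rfl
  have hadj := hl.adj (List.getElem_mem hi)
  have e0 := eval_edgeEnd_zero hs'.ends hx hi
  have e1 := eval_edgeEnd_one hs'.ends hx hi
  have ew := eval_edgeWeight hs'.weights hx hi
  refine Ensures.step (Ensures.edge ?_)
  set s₁ : State := { s' with query := s'.query ++
    [((edgeEnd 0).eval s', (edgeEnd 1).eval s', edgeWeight.eval s')] }
  have e0' : (edgeEnd 0).eval s₁ = l[i].1 := eval_edgeEnd_zero hs'.ends hx hi
  have e1' : (edgeEnd 1).eval s₁ = l[i].2 := eval_edgeEnd_one hs'.ends hx hi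
  have ew' : edgeWeight.eval s₁ = G.pairWeight l[i] := eval_edgeWeight hs'.weights hx hi
  have sc0 : (secondCopy (edgeEnd 0)).eval s₁ = n + l[i].1 := by
    simp only [secondCopy, IExp.eval, e0']
    exact hs'.second _ l[i].1.2.le
  have sc1 : (secondCopy (edgeEnd 1)).eval s₁ = n + l[i].2 := by
    simp only [secondCopy, IExp.eval, e1']
    exact hs'.second _ l[i].2.2.le
  have hq₁ : s₁.query = s'.query ++ [((l[i].1 : ℕ), (l[i].2 : ℕ), (G.pairWeight l[i] : ℝ≥0∞))] := by
    rw [← e0, ← e1, ← ew]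
  have hw₁ : s₁.wreg 2 = s.wreg 2 := hw2
  have ho₁ := ho s₁ hia i hi hx
  have happ : ∀ l₁ l₂, (G.twoCopies (scaleArcs G r (s.wreg 2))).encode (l₁ ++ l₂) =
      (G.twoCopies (scaleArcs G r (s.wreg 2))).encode l₁ ++
        (G.twoCopies (scaleArcs G r (s.wreg 2))).encode l₂ := fun l₁ l₂ => by simp [encode]
  rw [List.take_succ_eq_append_getElem hi, List.flatMap_append, happ, ← h, List.flatMap_singleton,
    encode_copies G hadj (hr _ _ hadj.ne)]
  refine Ensures.ite (T := 2) ?_ ?_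
  · intro hc
    simp only [Test.Holds, WExp.eval, ew', hw₁, not_lt] at hc
    rw [if_pos hc]
    refine Ensures.ite (T := 1) ?_ ?_
    · intro ht
      rw [if_pos (ho₁.1 ht)]
      refine Ensures.edge ?_
      simp [e0', sc1, ew', hq₁]
    · intro ht
      rw [if_neg fun h => ht (ho₁.2 h)]
      refine Ensures.edge ?_
      simp [e1', sc0, ew', hq₁]
  · intro hc
    simp only [Test.Holds, WExp.eval, ew', hw₁, not_lt] at hc
    rw [if_neg hc]
    refine Ensures.skip ?_
    simp [hq₁]

/-- `c` bounds from above the length of a walk from `y` to `z` that ends with an arc of `r` and is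
not a detour via `z`. -/
def SoundAt (G : WGraph n) (r : Fin n → Fin n → Prop) (y z : Fin n) (c : ℝ≥0∞) : Prop :=
  c = ⊤ ∨ ∃ u, G.graph.Adj u z ∧ r u z ∧ G.dist y u < G.dist y z + G.weight s(u, z) ∧
    G.dist y u + G.weight s(u, z) ≤ c

/-- `c` is at most the length of walks from `y` to `z` that end with an arc of `r` of weight less
than `a` from a node that is not farther from `y` than `z`. -/
def CompleteAt (G : WGraph n) (r : Fin n → Fin n → Prop) (a : ℝ≥0∞) (y z : Fin n) (c : ℝ≥0∞) :
    Prop :=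
  ∀ u, G.graph.Adj u z → r u z → G.weight s(u, z) < a → G.dist y u ≤ G.dist y z →
    c ≤ G.dist y u + G.weight s(u, z)

/-! ### Accepting or rejecting a cross distance at one scale -/

section Relax

variable {G : WGraph n} {r : Fin n → Fin n → Prop} {a c : ℝ≥0∞} {y z : Fin n}

/-- The last edge weighs at least `a`, so the accepted value is below d(y,z) + 2w(u,z). Cancelling
one w(u,z) gives exactly the inequality that excludes detours via z. -/
lemma soundAt_relax
    (hlt : (G.twoCopies (scaleArcs G r a)).dist (lo y) (hi z) < G.dist y z + (a + a)) :
    SoundAt G r y z ((G.twoCopies (scaleArcs G r a)).dist (lo y) (hi z)) := by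
  obtain ⟨u, hadj, ⟨hr, ha, -⟩, hle⟩ := G.exists_twoCopies_dist_lo_hi _ hlt.ne_top
  refine Or.inr ⟨u, hadj, hr, ?_, hle⟩
  have h1 : G.dist y u + G.weight s(u, z) < (G.dist y z + G.weight s(u, z)) + G.weight s(u, z) := by
    refine (hle.trans_lt hlt).trans_le ?_
    rw [add_assoc]
    gcongr
  exact lt_of_add_lt_add_right h1

lemma completeAt_relax_pos (h : CompleteAt G r a y z c)
    (hlt : (G.twoCopies (scaleArcs G r a)).dist (lo y) (hi z) ≤ c) :
    CompleteAt G r (a + a) y z ((G.twoCopies (scaleArcs G r a)).dist (lo y) (hi z)) := by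
  intro u hadj hr hw hd
  by_cases hwa : (G.weight s(u, z) : ℝ≥0∞) < a
  · exact hlt.trans (h u hadj hr hwa hd)
  · exact G.twoCopies_dist_lo_hi_le _ hadj ⟨hr, not_lt.1 hwa, hw⟩

/-- For an arc of this scale from a node not farther from y than z, the cross distance always passes
the first test because w(u,z) < 2a. A rejection then means that the old candidate was at least as
good. -/
lemma completeAt_relax_neg (h : CompleteAt G r a y z c)
    (hn : ¬ ((G.twoCopies (scaleArcs G r a)).dist (lo y) (hi z) < G.dist y z + (a + a) ∧
      (G.twoCopies (scaleArcs G r a)).dist (lo y) (hi z) < c)) :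
    CompleteAt G r (a + a) y z c := by
  intro u hadj hr hw hd
  by_cases hwa : (G.weight s(u, z) : ℝ≥0∞) < a
  · exact h u hadj hr hwa hd
  have hle := G.twoCopies_dist_lo_hi_le (y := y) (scaleArcs G r a) hadj ⟨hr, not_lt.1 hwa, hw⟩
  by_cases ht : G.dist y u = ⊤
  · simp [ht]
  -- Finiteness is needed for the strict inequality d(y,z) + w(u,z) < d(y,z) + 2a.
  have htz : G.dist y z ≠ ⊤ :=
    ((G.dist_le_dist_add hadj).trans_lt (ENNReal.add_lt_top.2 ⟨lt_top_iff_ne_top.2 ht, by simp⟩)).ne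
  have hlt : (G.twoCopies (scaleArcs G r a)).dist (lo y) (hi z) < G.dist y z + (a + a) := by
    refine hle.trans_lt (lt_of_le_of_lt (b := G.dist y z + G.weight s(u, z)) (by gcongr) ?_)
    exact ENNReal.add_lt_add_left htz hw
  by_contra hc
  exact hn ⟨hlt, hle.trans_lt (not_le.1 hc)⟩

end Relax

lemma table_APSD {N : ℕ} (H : WGraph N) (x y : Fin N) : APSD.table H x y = H.dist x y := by
  have : (x : ℕ) < APSD.rows N ∧ (y : ℕ) < APSD.cols N := ⟨x.2, y.2⟩
  rw [GraphProblem.table, dif_pos this]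
  rfl

lemma ensures_relax {Q : GraphProblem} {Φ : Call → Prop} {s : State} {G : WGraph n}
    {l : List (Fin n × Fin n)} {a b d : ℝ≥0∞} (hs : Prepared G l a b s) {k : ℕ} (hk : k ≠ 1)
    {r : Fin n → Fin n → Prop} (hd : s.wreg 2 = d)
    (htab : s.warr 1 = APSD.table (G.twoCopies (scaleArcs G r d)))
    (h : ∀ y z : Fin n, SoundAt G r y z (s.warr k y z) ∧ CompleteAt G r d y z (s.warr k y z)) :
    Ensures Q (relax k) s (n * (n * 4 + 4) + 2) 0 Φ fun s' =>
      ∀ y z : Fin n, SoundAt G r y z (s'.warr k y z) ∧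
        CompleteAt G r (d + d) y z (s'.warr k y z) := by
  refine Ensures.mono (Ensures.forLoop₂ (T := 2) (by exact ⟨rfl, rfl, rfl⟩) hs.nodes
    (fun _ => True)
    (fun y z s => ∀ (hy : y < n) (hz : z < n), SoundAt G r ⟨y, hy⟩ ⟨z, hz⟩ (s.warr k y z) ∧
      CompleteAt G r d ⟨y, hy⟩ ⟨z, hz⟩ (s.warr k y z))
    (fun y z s => ∀ (hy : y < n) (hz : z < n), SoundAt G r ⟨y, hy⟩ ⟨z, hz⟩ (s.warr k y z) ∧
      CompleteAt G r (d + d) ⟨y, hy⟩ ⟨z, hz⟩ (s.warr k y z))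
    (fun _ _ h => h) (fun _ _ _ _ h => h) (fun _ _ _ _ h => h) trivial
    (fun y _ z _ hy hz => h ⟨y, hy⟩ ⟨z, hz⟩) ?_) le_rfl le_rfl
    fun _ h y z => h.2 y y.2 z z.2 y.2 z.2
  intro y hy z hz s' hf h2 h3 _ hpre _
  have hst : s'.warr 1 = APSD.table (G.twoCopies (scaleArcs G r d)) := by
    rw [hf.warr 1 (by simpa [forLoop₂, forLoop, Prog.writesWArr] using hk.symm), htab]
  have hd' : s'.wreg 2 = d := by rw [hf.wreg 2 rfl, hd]
  have hsec : s'.iarr 4 z 0 = n + z := by rw [hf.iarr 4 rfl]; exact hs.second z hz.le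
  have ec : crossDist.eval s' =
      (G.twoCopies (scaleArcs G r d)).dist (lo ⟨y, hy⟩) (hi ⟨z, hz⟩) := by
    simp only [crossDist, secondCopy, WExp.eval, IExp.eval, h2, h3, hsec, hst]
    rw [← table_APSD]
    simp [lo, hi, add_comm]
  have ed : s'.warr 1 y z = G.dist ⟨y, hy⟩ ⟨z, hz⟩ := by
    rw [← G.twoCopies_dist_lo_lo (scaleArcs G r d), ← table_APSD, hst]
    rfl
  obtain ⟨hsound, hcomp⟩ := hpre hy hz
  refine Ensures.ite ?_ ?_
  · intro ht
    simp only [Test.Holds, WExp.eval, IExp.eval, ec, h2, h3, ed, hd'] at ht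
    refine Ensures.putW ⟨trivial, fun _ _ => ?_, fun y' z' hne => ?_⟩
    · simp only [setEntry_apply, IExp.eval, h2, h3, and_self, if_true, ec]
      exact ⟨soundAt_relax ht.1, completeAt_relax_pos hcomp ht.2.le⟩
    · simp only [setEntry_apply, IExp.eval, h2, h3, hne, and_false, if_false]
      exact ⟨id, id⟩
  · intro ht
    simp only [Test.Holds, WExp.eval, IExp.eval, ec, h2, h3, ed, hd'] at ht
    exact Ensures.skip ⟨trivial, fun _ _ => ⟨hsound, completeAt_relax_neg hcomp ht⟩,
      fun _ _ _ => ⟨id, id⟩⟩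

/-- The oracle calls of the reduction: copies of `G` of the required kind. -/
def AdmissibleCall (G : WGraph n) (K : ℕ) (q : Call) : Prop :=
  q.order = 2 * n ∧ q.graph.numEdges ≤ 2 * G.numEdges ∧ q.graph.ratio ≤ G.ratio ∧
    q.buildTime ≤ K * (n + G.numEdges) ∧
    ∀ a b : Fin q.order, q.graph.graph.Adj a b →
      ∃ x y : Fin n, (x : ℕ) = (a : ℕ) % n ∧ (y : ℕ) = (b : ℕ) % n ∧ G.graph.Adj x y ∧
        q.graph.weight s(a, b) = G.weight s(x, y)

lemma admissibleCall_twoCopies {G : WGraph n} {l : List (Fin n × Fin n)} (hl : G.IsEdgeList l)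
    {r : Fin n → Fin n → Prop} (hr : ∀ u v, G.graph.Adj u v → ¬ (r u v ∧ r v u)) {K t : ℕ}
    (ht : t ≤ K * (n + G.numEdges)) : AdmissibleCall G K ⟨2 * n, G.twoCopies r, t⟩ := by
  refine ⟨rfl, ?_, (G.ratio_twoCopies r).le, ht, fun a b hab => ?_⟩
  · rw [(G.isEdgeList_twoCopies r hl hr).numEdges_eq, hl.numEdges_eq]
    exact length_flatMap_copies_le r fun p hp => hr _ _ (hl.adj hp)
  · exact ⟨proj a, proj b, rfl, rfl, hab.1, G.twoCopies_weight r hab⟩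

lemma ensures_askAndRelax {s : State} {G : WGraph n} (hn : 0 < n)
    {l : List (Fin n × Fin n)} (hl : G.IsEdgeList l) {a b d : ℝ≥0∞} (hs : Prepared G l a b s)
    {o : Test} {r : Fin n → Fin n → Prop} (hr : ∀ u v, u ≠ v → (r v u ↔ ¬ r u v))
    (ho : TestsArc o r l s) {k : ℕ} (hk : k ≠ 1) (hd : s.wreg 2 = d)
    (h : ∀ y z : Fin n, SoundAt G r y z (s.warr k y z) ∧ CompleteAt G r d y z (s.warr k y z)) :
    Ensures APSD (askAndRelax o k) s (1 + (n * (n * 4 + 4) + 2)) 1 (AdmissibleCall G 6) fun s' =>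
      ∀ y z : Fin n, SoundAt G r y z (s'.warr k y z) ∧
        CompleteAt G r (d + d) y z (s'.warr k y z) := by
  have hrr : ∀ u v, G.graph.Adj u v → ¬ (scaleArcs G r d u v ∧ scaleArcs G r d v u) :=
    fun u v huv ⟨h1, h2⟩ => (hr u v huv.ne).1 h2.1 h1.1
  refine Ensures.seq' (T := 1) (C := 1) (C' := 0) (P' := fun s' =>
    s'.warr 1 = APSD.table (G.twoCopies (scaleArcs G r d)) ∧ s'.warr k = s.warr k) ?_ ?_
  · refine Ensures.call (C := 0) (T' := 0) (G.twoCopies (scaleArcs G r d)) _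
      (G.isEdgeList_twoCopies _ hl hrr)
      ((ensures_buildQuery hl (s := { s with query := [] }) ⟨hs.1, hs.2, hs.3, hs.4, hs.5, hs.6,
        hs.7, hs.8, hs.9⟩ hr ho rfl).post fun s₁ hq hf => ⟨?_, ?_, ?_, ?_⟩) fun t ht => ?_
    · rw [← hd]; exact hq
    · simp only [secondCopy, IExp.eval, hf.iarr 4 rfl, hf.ireg 0 rfl, hs.nodes]
      rw [hs.second n le_rfl, two_mul]
    · simp [answerArray]
    · simp [answerArray, hk, hf.warr k rfl]
    -- The writing time 6m + 2 is at most 6(n + m) because n is positive.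
    · refine admissibleCall_twoCopies hl hrr (ht.trans ?_)
      rw [hl.numEdges_eq]
      omega
  · rintro s' ⟨h1, h2⟩ hf
    refine ensures_relax (hs.of_frame hf ?_) hk ((hf.wreg 2 rfl).trans hd) h1 ?_
    · refine ⟨?_, ?_, ?_, ?_, ?_, ?_, ?_, ?_, ?_⟩ <;> rfl
    · rw [h2]; exact h

/-! ### The main loop -/

/-- After i halvings of the table of differences, the parity of an entry is digit i, which is what
`orient` tests. All entries are at most n, hence covered by the parity table. -/
lemma testsArc_arcTest {s : State} {G : WGraph n} {l : List (Fin n × Fin n)} {a b : ℝ≥0∞}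
    (hs : Prepared G l a b s) {i : ℕ}
    (hX : ∀ u < n, ∀ v < n, s.iarr 3 u v = (v - u - 1) / 2 ^ i) :
    TestsArc arcTest (fun u v => orient i u v) l s := by
  intro s' hs' e he hx
  have hends : s'.iarr 0 = (initState G l).iarr 0 := by rw [hs', hs.ends]
  have e0 := eval_edgeEnd_zero hends hx he
  have e1 := eval_edgeEnd_one hends hx he
  have hpar : ∀ u < n, ∀ v < n,
      s'.iarr 1 (s'.iarr 3 u v) 0 = (v - u - 1) / 2 ^ i % 2 := fun u hu v hv => by
    rw [hs', hX u hu v hv]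
    exact hs.parity _ ((Nat.div_le_self _ _).trans (by omega))
  have hp := hpar l[e].1 l[e].1.2 l[e].2 l[e].2.2
  have hp' := hpar l[e].2 l[e].2.2 l[e].1 l[e].1.2
  simp only [arcTest, evenTest, Test.Holds, IExp.eval, e0, e1, hp, hp', orient]
  split_ifs with h <;> simp [h]

lemma TestsArc.not {o : Test} {r : Fin n → Fin n → Prop} {l : List (Fin n × Fin n)} {s : State}
    (h : TestsArc o r l s) : TestsArc (.not o) (fun u v => ¬ r u v) l s :=
  fun s' hs' e he hx => not_congr (h s' hs' e he hx)

/-- The state of the candidates for tournament `i` once all scales below `d` are processed. -/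
def Candidates (G : WGraph n) (i : ℕ) (d : ℝ≥0∞) (s : State) : Prop :=
  (∀ y z : Fin n, SoundAt G (fun u v => orient i u v) y z (s.warr 3 y z) ∧
    CompleteAt G (fun u v => orient i u v) d y z (s.warr 3 y z)) ∧
  ∀ y z : Fin n, SoundAt G (fun u v => ¬ orient i u v) y z (s.warr 4 y z) ∧
    CompleteAt G (fun u v => ¬ orient i u v) d y z (s.warr 4 y z)

lemma ensures_scaleStep {s : State} {G : WGraph n} (hn : 0 < n) {l : List (Fin n × Fin n)}
    (hl : G.IsEdgeList l) {a b d : ℝ≥0∞} (hs : Prepared G l a b s) {i : ℕ}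
    (hX : ∀ u < n, ∀ v < n, s.iarr 3 u v = (v - u - 1) / 2 ^ i) (hd : s.wreg 2 = d)
    (h : Candidates G i d s) :
    Ensures APSD scaleStep s
      (1 + (n * (n * 4 + 4) + 2) + (1 + (n * (n * 4 + 4) + 2) + 1)) 2 (AdmissibleCall G 6) fun s' =>
      s'.wreg 2 = d + d ∧ Candidates G i (d + d) s' := by
  have hr : ∀ u v : Fin n, u ≠ v → (orient i v u ↔ ¬ orient i u v) := fun u v huv =>
    orient_swap i fun h => huv (Fin.ext h)
  refine Ensures.seq' (C' := 1 + 0) (ensures_askAndRelax hn hl hs hr (testsArc_arcTest hs hX)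
    (k := 3) (by decide) hd h.1) fun s₁ h₁ hf₁ => ?_
  have hs₁ : Prepared G l a b s₁ :=
    hs.of_frame hf₁ (by refine ⟨?_, ?_, ?_, ?_, ?_, ?_, ?_, ?_, ?_⟩ <;> rfl)
  have hX₁ : ∀ u < n, ∀ v < n, s₁.iarr 3 u v = (v - u - 1) / 2 ^ i := by
    rw [hf₁.iarr 3 rfl]; exact hX
  have hd₁ : s₁.wreg 2 = d := (hf₁.wreg 2 rfl).trans hd
  refine Ensures.seq' (T' := 0 + 1) (ensures_askAndRelax hn hl hs₁
    (fun u v huv => not_congr (hr u v huv)) (testsArc_arcTest hs₁ hX₁).not (k := 4) (by decide) hd₁ ?_) fun s₂ h₂ hf₂ => Ensures.setW ?_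
  · rw [hf₁.warr 4 rfl]; exact h.2
  · have hd₂ : s₂.wreg 2 = d := (hf₂.wreg 2 rfl).trans hd₁
    refine ⟨by simp [WExp.eval, hd₂], ?_, h₂⟩
    change ∀ y z : Fin n, SoundAt _ _ y z (s₂.warr 3 y z) ∧ CompleteAt _ _ _ y z (s₂.warr 3 y z)
    rw [hf₂.warr 3 rfl]
    exact h₁

lemma ensures_scales {s : State} {G : WGraph n} (hn : 0 < n) {l : List (Fin n × Fin n)}
    (hl : G.IsEdgeList l) {a b : ℝ≥0∞} (hs : Prepared G l a b s) {i : ℕ}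
    (hX : ∀ u < n, ∀ v < n, s.iarr 3 u v = (v - u - 1) / 2 ^ i) (hd : s.wreg 2 = a)
    (h : Candidates G i a s) {N : ℕ} (hN : ∀ k, k < N ↔ a * 2 ^ k ≤ b) :
    Ensures APSD (.while (.not (.wlt (.reg 1) (.reg 2))) scaleStep) s
      (N * (1 + (n * (n * 4 + 4) + 2) + (1 + (n * (n * 4 + 4) + 2) + 1) + 1) + 1) (N * 2) (AdmissibleCall G 6)
      (Candidates G i (a * 2 ^ N)) := by
  refine Ensures.mono (Ensures.whileLoop N
    (fun k s => s.wreg 2 = a * 2 ^ k ∧ Candidates G i (a * 2 ^ k) s)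
    ⟨by simpa using hd, by simpa using h⟩ ?_ ?_) le_rfl le_rfl fun _ h => h.2
  · rintro k hk s' hf ⟨h1, h2⟩
    have hs' : Prepared G l a b s' :=
      hs.of_frame hf (by refine ⟨?_, ?_, ?_, ?_, ?_, ?_, ?_, ?_, ?_⟩ <;> rfl)
    constructor
    · simpa [Test.Holds, WExp.eval, hs'.maximum, h1] using (hN k).1 hk
    · have := ensures_scaleStep hn hl hs' (i := i) (by rw [hf.iarr 3 rfl]; exact hX) h1 h2
      rwa [← mul_two, mul_assoc, ← pow_succ] at this
  · rintro s' hf ⟨h1, -⟩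
    have hs' : Prepared G l a b s' :=
      hs.of_frame hf (by refine ⟨?_, ?_, ?_, ?_, ?_, ?_, ?_, ?_, ?_⟩ <;> rfl)
    have := (hN N).not.1 (lt_irrefl N)
    simpa [Test.Holds, WExp.eval, hs'.maximum, h1] using this

/-- `M` will be the minimum cycle weight: the output only decreases, and only to candidate sums,
none of which is below `M`. Halving the differences and resetting the candidates prepares the next
tournament. -/
lemma ensures_collect {Q : GraphProblem} {Φ : Call → Prop} {s : State} {G : WGraph n}
    {l : List (Fin n × Fin n)} {a b : ℝ≥0∞} (hs : Prepared G l a b s)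
    (hX : ∀ y < n, ∀ z < n, s.iarr 3 y z ≤ n) {M : ℝ≥0∞}
    (hM : ∀ y < n, ∀ z < n, M ≤ s.warr 3 y z + s.warr 4 y z) (hout : M ≤ s.warr 2 0 0) :
    Ensures Q collect s (n * (n * 7 + 4) + 2) 0 Φ fun s' =>
      M ≤ s'.warr 2 0 0 ∧ s'.warr 2 0 0 ≤ s.warr 2 0 0 ∧ ∀ y < n, ∀ z < n,
        s'.warr 2 0 0 ≤ s.warr 3 y z + s.warr 4 y z ∧ s'.iarr 3 y z = s.iarr 3 y z / 2 ∧
        s'.warr 3 y z = ⊤ ∧ s'.warr 4 y z = ⊤ := by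
  refine Ensures.mono (Ensures.forLoop₂ (T := 5) (by exact ⟨rfl, rfl, rfl⟩) hs.nodes
    (fun s' => M ≤ s'.warr 2 0 0 ∧ s'.warr 2 0 0 ≤ s.warr 2 0 0)
    (fun y z s' => s'.iarr 3 y z = s.iarr 3 y z ∧ s'.warr 3 y z = s.warr 3 y z ∧
      s'.warr 4 y z = s.warr 4 y z)
    (fun y z s' => s'.warr 2 0 0 ≤ s.warr 3 y z + s.warr 4 y z ∧
      s'.iarr 3 y z = s.iarr 3 y z / 2 ∧ s'.warr 3 y z = ⊤ ∧ s'.warr 4 y z = ⊤)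
    (fun _ _ h => h) (fun _ _ _ _ h => h) (fun _ _ _ _ h => h) ⟨hout, le_rfl⟩
    (fun y _ z _ => ⟨rfl, rfl, rfl⟩) ?_) le_rfl le_rfl fun _ h => ⟨h.1.1, h.1.2, h.2⟩
  rintro y hy z hz s' hf h2 h3 ⟨hJ, hJ'⟩ ⟨hp1, hp2, hp3⟩ -
  have hhalf : s'.iarr 2 (s.iarr 3 y z) 0 = s.iarr 3 y z / 2 := by
    rw [hf.iarr 2 rfl]; exact hs.half _ (hX y hy z hz)
  have hsum : candidateSum.eval s' = s.warr 3 y z + s.warr 4 y z := by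
    simp [candidateSum, WExp.eval, IExp.eval, h2, h3, hp2, hp3]
  refine Ensures.seq' (T := 2) (T' := 3) (C := 0) (C' := 0) (P' := fun s₁ =>
    s₁.ireg = s'.ireg ∧ s₁.iarr = s'.iarr ∧ s₁.warr 3 = s'.warr 3 ∧ s₁.warr 4 = s'.warr 4 ∧
      M ≤ s₁.warr 2 0 0 ∧ s₁.warr 2 0 0 ≤ s'.warr 2 0 0 ∧
      s₁.warr 2 0 0 ≤ s.warr 3 y z + s.warr 4 y z) (Ensures.ite ?_ ?_) ?_
  · intro ht
    simp only [Test.Holds, WExp.eval, IExp.eval, hsum, outputArray] at ht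
    refine Ensures.putW ⟨rfl, rfl, ?_, ?_, ?_, ?_, ?_⟩
    · funext; simp [outputArray]
    · funext; simp [outputArray]
    · simpa [outputArray, IExp.eval, hsum] using hM y hy z hz
    · simpa [outputArray, IExp.eval, hsum] using ht.le
    · simp [outputArray, IExp.eval, hsum]
  · intro ht
    simp only [Test.Holds, WExp.eval, IExp.eval, hsum, outputArray, not_lt] at ht
    exact Ensures.skip ⟨rfl, rfl, rfl, rfl, hJ, le_rfl, ht⟩
  · rintro s₁ ⟨hi, ha, hw3, hw4, hM₁, hle, hle'⟩ -
    rw [← hi] at h2 h3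
    rw [← ha] at hp1 hhalf
    refine Ensures.step (Ensures.putI (Ensures.step (Ensures.putW (Ensures.putW ?_))))
    simp only [IExp.eval, WExp.eval, setEntry_apply, h2, h3]
    refine ⟨by simpa using ⟨hM₁, hle.trans hJ'⟩, by simpa [hp1, hhalf] using hle', ?_⟩
    intro y' z' hne
    simp only [hne, and_false, if_false, ha, hw3, hw4]
    refine ⟨by simp, ?_⟩
    simp only [and_imp]
    intro h1 h2 h3 h4
    exact ⟨by simpa using hle.trans h1, by simpa using h2, by simpa using h3, by simpa using h4⟩

/-- `c` is at most the length of all closed walks through `y` and `z` that reach `z` by edges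
distinguished by tournament `i`, from nodes not farther from `y` than `z`. -/
def Covered (G : WGraph n) (i : ℕ) (c : ℝ≥0∞) : Prop :=
  ∀ y z u v : Fin n, G.graph.Adj u z → G.graph.Adj v z → orient i u z → ¬ orient i v z →
    G.dist y u ≤ G.dist y z → G.dist y v ≤ G.dist y z →
    c ≤ (G.dist y u + G.weight s(u, z)) + (G.dist y v + G.weight s(v, z))

/-- The invariant of the main loop. -/
structure MainInvariant (G : WGraph n) (i : ℕ) (s : State) : Prop where
  counter : s.ireg 5 = (n - 1) / 2 ^ i
  cells : ∀ u < n, ∀ v < n, s.iarr 3 u v = (v - u - 1) / 2 ^ i ∧ s.warr 3 u v = ⊤ ∧ s.warr 4 u v = ⊤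
  sound : G.minCycleWeight ≤ s.warr 2 0 0
  covered : ∀ j < i, Covered G j (s.warr 2 0 0)

/-- The two witnesses lie on opposite sides of the tournament, so they are different neighbours of
z. -/
lemma minCycleWeight_le_of_soundAt {G : WGraph n} {r : Fin n → Fin n → Prop} {y z : Fin n}
    {c c' : ℝ≥0∞} (h : SoundAt G r y z c) (h' : SoundAt G (fun u v => ¬ r u v) y z c') :
    G.minCycleWeight ≤ c + c' := by
  rcases h with rfl | ⟨u, hu, hru, hlt, hle⟩
  · simp
  rcases h' with rfl | ⟨v, hv, hrv, hlt', hle'⟩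
  · simp
  refine (G.minCycleWeight_le_of_neighbors hu hv ?_ hlt hlt').trans (add_le_add hle hle')
  rintro rfl
  exact hrv hru

lemma ensures_tournamentStep {s : State} {G : WGraph n} (hn : 0 < n) {l : List (Fin n × Fin n)}
    (hl : G.IsEdgeList l) {a b : ℝ≥0∞} (hab : IsExtremes G l a b) (hs : Prepared G l a b s) {i : ℕ}
    (h : MainInvariant G i s) {N : ℕ} (hN : ∀ k, k < N ↔ a * 2 ^ k ≤ b) :
    Ensures APSD tournamentStep s
      (N * (1 + (n * (n * 4 + 4) + 2) + (1 + (n * (n * 4 + 4) + 2) + 1) + 1) + 1 + (n * (n * 7 + 4) + 2 + 1) + 1) (N * 2)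
      (AdmissibleCall G 6) (MainInvariant G (i + 1)) := by
  refine Ensures.step (Ensures.setW ?_)
  have hweight : ∀ u v : Fin n, G.graph.Adj u v → a ≤ G.weight s(u, v) ∧ G.weight s(u, v) ≤ b := by
    intro u v huv
    rcases hl.exists_mem huv with hm | hm
    · exact ⟨hab.le _ hm, hab.ge _ hm⟩
    · rw [Sym2.eq_swap]
      exact ⟨hab.le _ hm, hab.ge _ hm⟩
  refine Ensures.seq' (C' := 0) (ensures_scales hn hl (i := i) (hs.of_frame
    (Run.setW (Q := APSD) s 2 (.reg 0)).frame ?_) (fun u hu v hv => (h.cells u hu v hv).1)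
    (by simp [WExp.eval, hs.minimum]) ?_ hN) ?_
  · refine ⟨?_, ?_, ?_, ?_, ?_, ?_, ?_, ?_, ?_⟩ <;> rfl
  -- The candidates are `∞`, and completeness below the smallest weight `a` is vacuous.
  · refine ⟨fun y z => ⟨Or.inl (h.cells y y.2 z z.2).2.1, fun u hu _ hlt => ?_⟩,
      fun y z => ⟨Or.inl (h.cells y y.2 z z.2).2.2, fun u hu _ hlt => ?_⟩⟩
    · exact absurd hlt (not_lt.2 (hweight u z hu).1)
    · exact absurd hlt (not_lt.2 (hweight u z hu).1)
  intro s₁ h₁ hf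
  have hf₁ : Frame (.seq (.setW 2 (.reg 0)) (.while (.not (.wlt (.reg 1) (.reg 2))) scaleStep))
      s s₁ := ((Run.setW (Q := APSD) s 2 (.reg 0)).frame.mono (Prog.writesLE_seq_left _ _)).trans
    (hf.mono (Prog.writesLE_seq_right _ _))
  have hs₁ : Prepared G l a b s₁ :=
    hs.of_frame hf₁ (by refine ⟨?_, ?_, ?_, ?_, ?_, ?_, ?_, ?_, ?_⟩ <;> rfl)
  have hX : ∀ u < n, ∀ v < n, s₁.iarr 3 u v = (v - u - 1) / 2 ^ i := fun u hu v hv => by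
    rw [hf₁.iarr 3 rfl]
    exact (h.cells u hu v hv).1
  have hout : s₁.warr 2 = s.warr 2 := hf₁.warr 2 rfl
  refine Ensures.seq' (C := 0) (C' := 0) (T' := 0 + 1) (ensures_collect hs₁ ?_
    (M := G.minCycleWeight) ?_ ?_) ?_
  · intro y hy z hz
    rw [hX y hy z hz]
    exact (Nat.div_le_self _ _).trans (by omega)
  · intro y hy z hz
    exact minCycleWeight_le_of_soundAt (h₁.1 ⟨y, hy⟩ ⟨z, hz⟩).1 (h₁.2 ⟨y, hy⟩ ⟨z, hz⟩).1
  · rw [hout]; exact h.sound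
  rintro s₂ ⟨hM, hle, hcells⟩ hf₂
  have hs₂ : Prepared G l a b s₂ :=
    hs₁.of_frame hf₂ (by refine ⟨?_, ?_, ?_, ?_, ?_, ?_, ?_, ?_, ?_⟩ <;> rfl)
  have hr : s₂.ireg 5 = (n - 1) / 2 ^ i := by
    rw [hf₂.ireg 5 rfl, hf₁.ireg 5 rfl, h.counter]
  refine Ensures.setI ⟨?_, ?_, hM, ?_⟩
  · simp only [IExp.eval, hr, Function.update_self]
    rw [hs₂.half _ ((Nat.div_le_self _ _).trans (by omega)), pow_succ, Nat.div_div_eq_div_mul]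
  · intro u hu v hv
    obtain ⟨-, h1, h2, h3⟩ := hcells u hu v hv
    refine ⟨?_, h2, h3⟩
    change s₂.iarr 3 u v = _
    rw [h1, hX u hu v hv, pow_succ, Nat.div_div_eq_div_mul]
  · intro j hj
    by_cases hji : j < i
    · intro y z u v hu hv h1 h2 h3 h4
      refine hle.trans ?_
      rw [hout]
      exact h.covered j hji y z u v hu hv h1 h2 h3 h4
    · obtain rfl : j = i := by omega
      intro y z u v hu hv h1 h2 h3 h4
      -- The loop stopped beyond the largest weight, so the weight restriction in `CompleteAt` is
      -- met by every edge.
      have hb : b < a * 2 ^ N := not_le.1 ((hN N).not.1 (lt_irrefl N))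
      refine (hcells y y.2 z z.2).1.trans (add_le_add ?_ ?_)
      · exact (h₁.1 y z).2 u hu h1 ((hweight u z hu).2.trans_lt hb) h3
      · exact (h₁.2 y z).2 v hv h2 ((hweight v z hv).2.trans_lt hb) h4

/-- Each cycle supplies a farthest vertex with two neighbours, and one of the first L tournaments
separates them, up to exchanging the two. -/
lemma minCycleWeight_eq_of_mainInvariant {s : State} {G : WGraph n} {L : ℕ} (hL : n ≤ 2 ^ L)
    (h : MainInvariant G L s) : s.warr 2 0 0 = G.minCycleWeight := by
  refine le_antisymm (le_iInf fun y => le_iInf fun c => le_iInf fun hc => ?_) h.sound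
  obtain ⟨z, u, v, huv, hu, hv, hdu, hdv, hle⟩ := G.exists_neighbors_of_isCycle c hc
  refine le_trans ?_ hle
  obtain ⟨i, hi, ⟨h1, h2⟩ | ⟨h1, h2⟩⟩ := exists_orient hL u.2 v.2 z.2
    (fun h => huv (Fin.ext h)) (fun h => hu.ne (Fin.ext h)) fun h => hv.ne (Fin.ext h)
  · exact h.covered i hi y z u v hu hv h1 h2 hdu hdv
  · rw [add_comm]
    exact h.covered i hi y z v u hv hu h1 h2 hdv hdu

/-! ### The number of scales -/

lemma WGraph.one_le_ratio (G : WGraph n) : 1 ≤ G.ratio := by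
  unfold ratio
  split_ifs with h
  · exact le_rfl
  have hfin : (G.weight '' G.graph.edgeSet).Finite := Set.toFinite _
  have hne : (G.weight '' G.graph.edgeSet).Nonempty := by
    rw [Set.image_nonempty, Set.nonempty_iff_ne_empty]
    rintro he
    exact h (by simp [numEdges, he])
  obtain ⟨e, he, hmin⟩ : G.minWeight ∈ G.weight '' G.graph.edgeSet := hne.csInf_mem hfin
  have hpos : (0 : ℝ) < G.minWeight := by
    rw [← hmin]
    exact G.weight_pos e he
  rw [one_le_div hpos]
  have : G.minWeight ≤ G.maxWeight := csInf_le_csSup hne hfin.bddBelow hfin.bddAbove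
  exact_mod_cast this

/-- If there is an edge, the condition reads 2 ^ k ≤ ρ, that is, k ≤ ⌊log ρ⌋. Without edges `∞ * 2 ^
k ≤ 0` never holds, and no scale is processed. -/
lemma IsExtremes.exists_scales {G : WGraph n} {l : List (Fin n × Fin n)} (hl : G.IsEdgeList l)
    {a b : ℝ≥0∞} (h : IsExtremes G l a b) :
    ∃ N ≤ ⌊Real.logb 2 G.ratio⌋₊ + 1, ∀ k, k < N ↔ a * 2 ^ k ≤ b := by
  rcases h.eq with ⟨rfl, rfl⟩ | ⟨p, hp, rfl⟩
  · refine ⟨0, by omega, fun k => ?_⟩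
    have hb : b = 0 := by simpa using h.eq'
    simp [hb, ENNReal.top_mul]
  obtain ⟨q, hq, rfl⟩ : ∃ q ∈ l, b = G.pairWeight q := by
    rcases h.eq' with rfl | h
    · exact ⟨p, hp, (le_antisymm (h.ge p hp) bot_le).symm⟩
    · exact h
  have hmem : ∀ e ∈ G.graph.edgeSet, ∃ p ∈ l, s(p.1, p.2) = e := fun e he =>
    List.mem_map.1 ((hl.2 e).1 he)
  have hmin : G.minWeight = G.weight s(p.1, p.2) := by
    refine IsLeast.csInf_eq ⟨⟨_, hl.adj hp, rfl⟩, ?_⟩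
    rintro _ ⟨e, he, rfl⟩
    obtain ⟨x, hx, rfl⟩ := hmem e he
    exact_mod_cast h.le x hx
  have hmax : G.maxWeight = G.weight s(q.1, q.2) := by
    refine IsGreatest.csSup_eq ⟨⟨_, hl.adj hq, rfl⟩, ?_⟩
    rintro _ ⟨e, he, rfl⟩
    obtain ⟨x, hx, rfl⟩ := hmem e he
    exact_mod_cast h.ge x hx
  have hpos : (0 : ℝ) < G.weight s(p.1, p.2) := G.weight_pos _ (hl.adj hp)
  have hratio : G.ratio = G.weight s(q.1, q.2) / G.weight s(p.1, p.2) := by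
    rw [ratio, if_neg, hmin, hmax]
    rw [hl.numEdges_eq]
    exact (List.length_pos_of_mem hp).ne'
  have hone := G.one_le_ratio
  refine ⟨_, le_rfl, fun k => ?_⟩
  rw [Nat.lt_succ_iff, Nat.le_floor_iff (Real.logb_nonneg one_lt_two hone),
    Real.le_logb_iff_rpow_le one_lt_two (by linarith), Real.rpow_natCast, hratio, le_div_iff₀ hpos,
    mul_comm]
  simp only [WGraph.pairWeight]
  norm_cast

/-! ### The whole program -/

/-- The running time of `prepareTables`, `prepareDifferences`, `prepareExtremes` and two steps. -/
def prepareTime (n m : ℕ) : ℕ :=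
  n * 5 + 2 + 2 + (n * (n * 6 + 4) + 2 + (m * 6 + 2 + 1 + (1 + 1)))

/-- The running time of one round of the main loop with `N` scales. -/
def roundTime (n N : ℕ) : ℕ :=
  N * (1 + (n * (n * 4 + 4) + 2) + (1 + (n * (n * 4 + 4) + 2) + 1) + 1) + 1 +
    (n * (n * 7 + 4) + 2 + 1) + 1

lemma ensures_prepare (G : WGraph n) {l : List (Fin n × Fin n)} :
    Ensures APSD prepare (initState G l) (prepareTime n l.length) 0 (AdmissibleCall G 6) fun s =>
      MainInvariant G 0 s ∧ ∃ a b, IsExtremes G l a b ∧ Prepared G l a b s := by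
  refine Ensures.seq' (C := 0) (C' := 0) (ensures_prepareTables (n := n) (by simp [initState])
    (by simp [initState]) (by simp [initState])) ?_
  rintro s₁ ⟨hpar, hhalf, hsec⟩ hf₁
  refine Ensures.seq' (C := 0) (C' := 0) (ensures_prepareDifferences (n := n)
    (by rw [hf₁.ireg 0 rfl]; simp [initState])) ?_
  rintro s₂ h₂ hf₂
  refine Ensures.seq' (C := 0) (C' := 0) (ensures_prepareExtremes (G := G) (l := l)
    (by rw [hf₂.ireg 1 rfl, hf₁.ireg 1 rfl]; simp [initState])
    (by rw [hf₂.warr 0 rfl, hf₁.warr 0 rfl])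
    (by rw [hf₂.wreg 1 rfl, hf₁.wreg 1 rfl]; simp [initState])) ?_
  rintro s₃ h₃ hf₃
  have hn : s₃.ireg 0 = n := by
    rw [hf₃.ireg 0 rfl, hf₂.ireg 0 rfl, hf₁.ireg 0 rfl]; simp [initState]
  have hs₃ : Prepared G l (s₃.wreg 0) (s₃.wreg 1) s₃ := by
    refine ⟨hn, ?_, ?_, ?_, ?_, ?_, ?_, rfl, rfl⟩
    · rw [hf₃.ireg 1 rfl, hf₂.ireg 1 rfl, hf₁.ireg 1 rfl]; simp [initState]
    · rw [hf₃.iarr 0 rfl, hf₂.iarr 0 rfl, hf₁.iarr 0 rfl]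
    · rw [hf₃.warr 0 rfl, hf₂.warr 0 rfl, hf₁.warr 0 rfl]
    · rw [hf₃.iarr 1 rfl, hf₂.iarr 1 rfl]; exact hpar
    · rw [hf₃.iarr 2 rfl, hf₂.iarr 2 rfl]; exact hhalf
    · rw [hf₃.iarr 4 rfl, hf₂.iarr 4 rfl]; exact hsec
  refine Ensures.post (P := fun s₄ => s₄.ireg 5 = n - 1 ∧ s₄.warr 2 0 0 = ⊤ ∧
    s₄.warr 3 = s₃.warr 3 ∧ s₄.warr 4 = s₃.warr 4) ?_ ?_
  · refine Ensures.step (T := 0 + 1) (Ensures.putW (Ensures.setI ⟨?_, ?_, ?_, ?_⟩))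
    · simp [IExp.eval, hn]
    · simp [IExp.eval, WExp.eval, outputArray]
    · funext; simp [outputArray]
    · funext; simp [outputArray]
  · rintro s₄ ⟨h5, hout, hw3, hw4⟩ hf₄
    refine ⟨⟨by simpa using h5, fun u hu v hv => ?_, by simp [hout], by simp⟩, _, _, h₃,
      hs₃.of_frame hf₄ (by refine ⟨?_, ?_, ?_, ?_, ?_, ?_, ?_, ?_, ?_⟩ <;> rfl)⟩
    rw [hw3, hw4, hf₄.iarr 3 rfl, hf₃.iarr 3 rfl, hf₃.warr 3 rfl, hf₃.warr 4 rfl]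
    simpa using h₂ u hu v hv

lemma ensures_mwcProgram (G : WGraph n) {l : List (Fin n × Fin n)} (hl : G.IsEdgeList l) :
    ∃ N ≤ ⌊Real.logb 2 G.ratio⌋₊ + 1, Ensures APSD mwcProgram (initState G l)
      (prepareTime n l.length + (Nat.clog 2 n * (roundTime n N + 1) + 1))
      (0 + Nat.clog 2 n * (N * 2)) (AdmissibleCall G 6)
      fun s => s.warr 2 0 0 = G.minCycleWeight := by
  -- The run of `prepare` is unpacked first because `N` depends on the extreme weights that it
  -- finds.
  obtain ⟨s₁, t, q, hrun, ht, hq, hΦ, h0, a, b, hab, hs⟩ := ensures_prepare G (l := l)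
  obtain ⟨N, hNle, hN⟩ := hab.exists_scales hl
  refine ⟨N, hNle, Ensures.seq ⟨s₁, t, q, hrun, ht, hq, hΦ, ?_⟩⟩
  have hclog : ∀ i, i < Nat.clog 2 n ↔ 2 ^ i < n := fun i => Nat.lt_clog_iff_pow_lt one_lt_two
  -- Repeatedly halving n - 1 counts out exactly ⌈log n⌉ rounds, and none if n ≤ 1.
  have htest : ∀ i, 0 < (n - 1) / 2 ^ i ↔ 2 ^ i < n := fun i => by
    have := Nat.one_le_two_pow (n := i)
    rw [Nat.div_pos_iff]
    omega
  refine Ensures.mono (Ensures.whileLoop (Nat.clog 2 n) (MainInvariant G) h0 ?_ ?_) le_rfl le_rfl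
    fun s h => minCycleWeight_eq_of_mainInvariant (Nat.le_pow_clog one_lt_two n) h
  · intro i hi s' hf h
    have hi' := (hclog i).1 hi
    refine ⟨?_, ensures_tournamentStep (Nat.zero_lt_of_lt hi') hl hab (hs.of_frame hf ?_) h hN⟩
    · simpa only [Test.Holds, IExp.eval, h.counter] using (htest i).2 hi'
    · refine ⟨?_, ?_, ?_, ?_, ?_, ?_, ?_, ?_, ?_⟩ <;> rfl
  · intro s' hf h
    simp only [Test.Holds, IExp.eval, h.counter, htest, ← hclog]
    exact lt_irrefl _

lemma WGraph.IsEdgeList.length_le {G : WGraph n} {l : List (Fin n × Fin n)} (hl : G.IsEdgeList l) :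
    l.length ≤ n * n := by
  simpa using (List.Nodup.of_map _ hl.1).length_le_card

/-! ### Running time estimates and the tilde form of the reduction -/

lemma logb_natCast_nonneg (n : ℕ) : 0 ≤ Real.logb 2 n := by
  rcases Nat.eq_zero_or_pos n with rfl | hn
  · simp
  · exact Real.logb_nonneg one_lt_two (by exact_mod_cast hn)

/-- For n ≥ 2 one has log n ≥ 1, hence ⌈log n⌉ ≤ 2 log n and 1 + log ρ ≤ log (nρ). For n ≤ 1 the
main loop is not entered and only a bounded preparation remains. -/
lemma time_le {m N : ℕ} {ρ : ℝ} (hm : m ≤ n * n) (hρ : 1 ≤ ρ) (hN : N ≤ ⌊Real.logb 2 ρ⌋₊ + 1) :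
    ((prepareTime n m + (Nat.clog 2 n * (roundTime n N + 1) + 1) : ℕ) : ℝ) ≤
      100 * ((n : ℝ) ^ 2 * Real.logb 2 n * Real.logb 2 (n * ρ) + 1) := by
  have hy : 0 ≤ Real.logb 2 ρ := Real.logb_nonneg one_lt_two hρ
  rcases Nat.lt_or_ge n 2 with hn | hn
  · have h1 : Nat.clog 2 n = 0 := Nat.clog_of_right_le_one (by omega) _
    have h2 : prepareTime n m + (Nat.clog 2 n * (roundTime n N + 1) + 1) ≤ 100 := by
      rw [h1, prepareTime]
      interval_cases n <;> omega
    have h3 : Real.logb 2 n = 0 := by interval_cases n <;> simp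
    rw [h3]
    have h4 : ((prepareTime n m + (Nat.clog 2 n * (roundTime n N + 1) + 1) : ℕ) : ℝ) ≤ 100 := by
      exact_mod_cast h2
    linarith
  have hn' : (2 : ℝ) ≤ n := by exact_mod_cast hn
  have hx : 1 ≤ Real.logb 2 n := by
    rw [Real.le_logb_iff_rpow_le one_lt_two (by linarith)]
    simpa using hn'
  have hL : (Nat.clog 2 n : ℝ) ≤ 2 * Real.logb 2 n := by
    have := Nat.ceil_lt_add_one (logb_natCast_nonneg n)
    rw [show (2 : ℝ) = (2 : ℕ) by norm_num, Real.natCeil_logb_natCast] at this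
    push_cast at this
    linarith
  have hN' : (N : ℝ) ≤ Real.logb 2 ρ + 1 := by
    have h1 : (N : ℝ) ≤ (⌊Real.logb 2 ρ⌋₊ : ℝ) + 1 := by exact_mod_cast hN
    have h2 := Nat.floor_le hy
    linarith
  rw [Real.logb_mul (by linarith) (by linarith)]
  have hA : (prepareTime n m : ℝ) + 1 ≤ 20 * (n : ℝ) ^ 2 := by
    have : prepareTime n m + 1 ≤ 20 * n ^ 2 := by
      unfold prepareTime
      nlinarith
    exact_mod_cast this
  have hB : (roundTime n N : ℝ) + 1 ≤ (n : ℝ) ^ 2 * (14 * N + 11) := by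
    have : roundTime n N + 1 ≤ n ^ 2 * (14 * N + 11) := by
      have h1 : 1 + (n * (n * 4 + 4) + 2) + (1 + (n * (n * 4 + 4) + 2) + 1) + 1 ≤ 14 * n ^ 2 := by
        nlinarith
      have h2 := Nat.mul_le_mul_left N h1
      unfold roundTime
      nlinarith
    exact_mod_cast this
  push_cast
  set x := Real.logb 2 n
  set y := Real.logb 2 ρ
  have hn2 : (0 : ℝ) ≤ (n : ℝ) ^ 2 := by positivity
  have hxy : 1 + y ≤ x + y := by linarith
  -- Here 14N + 11 ≤ 25(1 + log ρ). The main loop contributes 50 and the preparation 20 to the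
  -- constant, within 100.
  have h1 : (Nat.clog 2 n : ℝ) * ((roundTime n N : ℝ) + 1) ≤
      2 * x * ((n : ℝ) ^ 2 * (25 * (x + y))) := by
    refine mul_le_mul hL (hB.trans ?_) (by positivity) (by linarith)
    gcongr
    linarith
  have h2 : (n : ℝ) ^ 2 * 1 ≤ (n : ℝ) ^ 2 * (x * (x + y)) := by
    gcongr
    nlinarith
  nlinarith

lemma AdmissibleCall.mono {G : WGraph n} {K K' : ℕ} {q : Call} (h : AdmissibleCall G K q)
    (hK : K ≤ K') : AdmissibleCall G K' q :=
  ⟨h.1, h.2.1, h.2.2.1, h.2.2.2.1.trans (Nat.mul_le_mul_right _ hK), h.2.2.2.2⟩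

/-- The program `c` is a reduction as in the first part of the theorem. -/
def IsReduction (c : Prog) (K : ℕ) : Prop :=
  ∀ (n : ℕ) (G : WGraph n) (l : List (Fin n × Fin n)), G.IsEdgeList l →
    ∃ (s : State) (t : ℕ) (calls : List Call),
      Run APSD c (initState G l) s t calls ∧
      Solves MWC G s ∧
      calls.length ≤ 2 * ⌈Real.logb 2 n⌉₊ * (⌊Real.logb 2 G.ratio⌋₊ + 1) ∧
      (t : ℝ) ≤ K * ((n : ℝ) ^ 2 * Real.logb 2 n * Real.logb 2 (n * G.ratio) + 1) ∧
      ∀ q ∈ calls, AdmissibleCall G K q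

lemma isReduction_mwcProgram : IsReduction mwcProgram 100 := by
  intro n G l hl
  obtain ⟨N, hN, s, t, calls, hrun, ht, hcalls, hΦ, hs⟩ := ensures_mwcProgram G hl
  refine ⟨s, t, calls, hrun, ?_, ?_, ?_, fun q hq => (hΦ q hq).mono (by norm_num)⟩
  · intro i j
    have hi : (i : ℕ) = 0 := Nat.lt_one_iff.1 i.2
    have hj : (j : ℕ) = 0 := Nat.lt_one_iff.1 j.2
    rw [hi, hj]
    exact hs
  · have h1 : ⌈Real.logb 2 n⌉₊ = Nat.clog 2 n := by exact_mod_cast Real.natCeil_logb_natCast 2 n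
    rw [h1]
    have := Nat.mul_le_mul_left (2 * Nat.clog 2 n) hN
    nlinarith
  · have h1 := time_le hl.length_le G.one_le_ratio hN
    refine le_trans ?_ (h1.trans (by norm_num))
    exact_mod_cast ht

/-- Everything is measured by P = (1 + log n)² (1 + log ρ). Both the call count, up to a factor 2,
and the factor log n · log (nρ) of the time bound are at most P when n > 0. Writing a query is
absorbed by n² since m ≤ n². -/
lemma IsReduction.tildeSparseReduces {c : Prog} {K : ℕ} (h : IsReduction c K) :
    TildeSparseReduces MWC APSD (fun _ n => n ^ 2) := by
  -- Own processing costs K and at most 2P calls cost 2K + κ each, which gives 5K + 2κ. The extra 2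
  -- covers the number of calls and the sizes 2n and 2m.
  refine ⟨c, fun T ⟨hmono, κ, hκ⟩ => ⟨5 * K + 2 * κ + 2, 2, fun n G l hl => ?_⟩⟩
  obtain ⟨s, t, calls, hrun, hsolves, hcalls, ht, hq⟩ := h n G l hl
  have hx := logb_natCast_nonneg n
  have hy : 0 ≤ Real.logb 2 G.ratio := Real.logb_nonneg one_lt_two G.one_le_ratio
  have hm : G.numEdges ≤ n ^ 2 := by
    rw [hl.numEdges_eq, pow_two]
    exact hl.length_le
  have hprod : (n : ℝ) ^ 2 * Real.logb 2 n * Real.logb 2 (n * G.ratio) =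
      (n : ℝ) ^ 2 * (Real.logb 2 n * (Real.logb 2 n + Real.logb 2 G.ratio)) := by
    rcases Nat.eq_zero_or_pos n with rfl | hn
    · simp
    · rw [Real.logb_mul (by positivity) (by linarith [G.one_le_ratio]), mul_assoc]
  rw [hprod] at ht
  have hcalls' : (calls.length : ℝ) ≤
      2 * ((1 + Real.logb 2 n) ^ 2 * (1 + Real.logb 2 G.ratio)) := by
    have h1 : (calls.length : ℝ) ≤
        2 * (⌈Real.logb 2 n⌉₊ : ℝ) * ((⌊Real.logb 2 G.ratio⌋₊ : ℝ) + 1) := by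
      exact_mod_cast hcalls
    have h2 := (Nat.ceil_lt_add_one hx).le
    have h3 := Nat.floor_le hy
    refine h1.trans ?_
    rw [mul_assoc]
    exact mul_le_mul_of_nonneg_left
      (mul_le_mul (by nlinarith) (by linarith) (by positivity) (by positivity)) zero_le_two
  unfold tildeFactor
  set x := Real.logb 2 n
  set y := Real.logb 2 G.ratio
  set P := (1 + x) ^ 2 * (1 + y) with hP
  have hP1 : 1 ≤ P := by
    have : 1 ≤ (1 + x) ^ 2 := by nlinarith
    nlinarith
  have hPx : x * (x + y) ≤ P := by
    have := mul_nonneg hx hy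
    have := mul_nonneg (mul_nonneg hx hx) hy
    rw [hP]
    nlinarith
  have hKP : ((5 * K + 2 * κ + 2 : ℕ) : ℝ) * (1 + x) ^ 2 * (1 + y) =
      ((5 * K + 2 * κ + 2 : ℕ) : ℝ) * P := by rw [hP]; ring
  simp only [hKP]
  have hfac : 2 * P ≤ ((5 * K + 2 * κ + 2 : ℕ) : ℝ) * P := by
    gcongr
    exact_mod_cast (by omega : 2 ≤ 5 * K + 2 * κ + 2)
  have hfac2 : 2 ≤ ((5 * K + 2 * κ + 2 : ℕ) : ℝ) * P := by linarith
  refine ⟨s, t, calls, hrun, hsolves, hcalls'.trans hfac, fun q hqc => ⟨?_, ?_⟩, ?_⟩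
  · have h1 : (q.order : ℝ) = 2 * n := by exact_mod_cast (hq q hqc).1
    rw [h1]
    gcongr
  · have h1 : (q.graph.numEdges : ℝ) ≤ 2 * G.numEdges := by exact_mod_cast (hq q hqc).2.1
    refine h1.trans ?_
    gcongr
  · have hsum : (calls.map fun q => q.buildTime + T q.graph.numEdges q.order).sum ≤
        calls.length * ((2 * K + κ) * (T G.numEdges n + n ^ 2 + 1)) := by
      rw [← smul_eq_mul, ← List.length_map (fun q : Call => q.buildTime + T q.graph.numEdges q.order)]
      refine List.sum_le_card_nsmul _ _ fun v hv => ?_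
      obtain ⟨q, hqc, rfl⟩ := List.mem_map.1 hv
      obtain ⟨h1, h2, -, h3, -⟩ := hq q hqc
      have h4 : T q.graph.numEdges q.order ≤ κ * (T G.numEdges n + 1) :=
        (hmono _ _ _ _ h2 h1.le).trans (hκ _ _)
      have h5 : q.buildTime ≤ K * (2 * n ^ 2) := by
        refine h3.trans (Nat.mul_le_mul_left K ?_)
        nlinarith [Nat.le_self_pow two_ne_zero n]
      have h6 : 0 ≤ K * (T G.numEdges n + 1) := Nat.zero_le _
      have h7 : 0 ≤ κ * n ^ 2 := Nat.zero_le _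
      nlinarith
    have hsum' : (((calls.map fun q => q.buildTime + T q.graph.numEdges q.order).sum : ℕ) : ℝ) ≤
        calls.length * ((2 * K + κ) * (T G.numEdges n + (n : ℝ) ^ 2 + 1)) := by
      exact_mod_cast hsum
    unfold totalTime
    push_cast at hsum' ⊢
    have hR : (0 : ℝ) ≤ (2 * K + κ) * (T G.numEdges n + (n : ℝ) ^ 2 + 1) := by positivity
    have h1 := mul_le_mul_of_nonneg_right hcalls' hR
    have h2 : (n : ℝ) ^ 2 * (x * (x + y)) + 1 ≤ P * (T G.numEdges n + (n : ℝ) ^ 2 + 1) := by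
      have h3 : (n : ℝ) ^ 2 * (x * (x + y)) ≤ (n : ℝ) ^ 2 * P := by gcongr
      have h4 : (0 : ℝ) ≤ P * T G.numEdges n := by positivity
      nlinarith
    have h3 : (K : ℝ) * ((n : ℝ) ^ 2 * (x * (x + y)) + 1) ≤
        K * (P * (T G.numEdges n + (n : ℝ) ^ 2 + 1)) := by gcongr
    have h4 : (0 : ℝ) ≤ P * (T G.numEdges n + (n : ℝ) ^ 2 + 1) := by positivity
    calc (t : ℝ) + _ ≤ K * (P * (T G.numEdges n + (n : ℝ) ^ 2 + 1)) +
        2 * P * ((2 * K + κ) * (T G.numEdges n + (n : ℝ) ^ 2 + 1)) :=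
          add_le_add (ht.trans h3) (hsum'.trans h1)
      _ ≤ _ := by nlinarith

end

end SparseReduction

theorem theorem1 :
    (∃ (c : Prog) (K : ℕ),
      ∀ (n : ℕ) (G : WGraph n) (l : List (Fin n × Fin n)), G.IsEdgeList l →
        ∃ (s : State) (t : ℕ) (calls : List Call),
          Run APSD c (initState G l) s t calls ∧
          Solves MWC G s ∧
          calls.length ≤ 2 * ⌈Real.logb 2 n⌉₊ * (⌊Real.logb 2 G.ratio⌋₊ + 1) ∧
          (t : ℝ) ≤ K * ((n : ℝ) ^ 2 * Real.logb 2 n * Real.logb 2 (n * G.ratio) + 1) ∧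
          ∀ q ∈ calls,
            q.order = 2 * n ∧
            q.graph.numEdges ≤ 2 * G.numEdges ∧
            q.graph.ratio ≤ G.ratio ∧
            q.buildTime ≤ K * (n + G.numEdges) ∧
            ∀ a b : Fin q.order, q.graph.graph.Adj a b →
              ∃ x y : Fin n, (x : ℕ) = (a : ℕ) % n ∧ (y : ℕ) = (b : ℕ) % n ∧
                G.graph.Adj x y ∧
                q.graph.weight s(a, b) = G.weight s(x, y)) ∧
    TildeSparseReduces MWC APSD (fun _ n => n ^ 2) :=
  ⟨⟨mwcProgram, 100, isReduction_mwcProgram⟩, isReduction_mwcProgram.tildeSparseReduces⟩
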